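/- Let $p\in(0,1)$, $p\neq\frac12$, $q=1-p$, and let $\mathbb{Z}_+=\{0,1,2,\dots\}$. For $x\ge 1$ let $m(x)$ be the largest $m$ such that $3^m$ divides $x$. The $pq$-Laplacian $\Delta_p$ acts on functions $f:\mathbb{Z}_+\to\mathbb{C}$ by $$(\Delta_pf)(x)=\begin{cases} f(0)-f(1), & x=0,\\ f(x)-qf(x-1)-pf(x+1), & 3^{-m(x)}x\equiv 1 \pmod 3,\\ f(x)-pf(x-1)-qf(x+1), & 3^{-m(x)}x\equiv 2\pmod 3.\end{cases}$$ Write $p(x,y)$ for the transition probabilities of the nearest neighbour random walk with $\Delta_p f(x)=f(x)-\sum_y p(x,y)f(y)$, and let $\pi$ be its reversible (symmetrizing) measure, given by $\pi(0)=1$ and $\pi(x)p(x,x+1)=\pi(x+1)p(x+1,x)$. Let $$R(z)=\frac{z(z^2-3z+2+pq)}{pq},$$ regarded as a map of the Riemann sphere $\mathbb{C}\cup\{\infty\}$ with $R(\infty)=\infty$, and let $\mathcal{J}(R)$ be its Julia set, that is, the complement of the set of all points that have a neighbourhood on which the iterates of $R$ form a normal family. Then the following holds. 1. $\Delta_p$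 is a bounded operator on $\ell^2(\mathbb{Z}_+)$ with spectrum $\sigma(\Delta_p)=\mathcal{J}(R)$, and it has purely singularly continuous spectrum there. As $\Delta_p$ need not be self-adjoint on $\ell^2(\mathbb{Z}_+)$, this means: the spectrum is a subset of $\mathbb{R}$ of Lebesgue measure zero; for every $z\in\sigma(\Delta_p)$ the operator $\Delta_p-z$ is injective and has dense range (there is neither point spectrum nor residual spectrum); and for all $x,y\in\mathbb{Z}_+$ there are finite Borel measures $\mu,\nu$ on $\mathbb{R}$, concentrated on $\sigma(\Delta_p)$, without atoms and singular with respect to Lebesgue measure, such that $(\Delta_p^n\delta_y)(x)=\int t^n\,d\mu(t)-\int t^n\,d\nu(t)$ for all $n\ge 0$. 2. $\Delta_p$ is a bounded self-adjoint operator on $L^2(\mathbb{Z}_+,\pi)$ with spectrum $\sigma(\Delta_p)=\mathcal{J}(R)$, and it has purely singularly continuous spectrum there: the spectral measure of every $f\in L^2(\mathbb{Z}_+,\pi)$ has no atoms and is singular with respect to Lebesgue measure. 3. $\mathcal{J}(R)$ is homeomorphic to the Cantor ternary set, and it is a subset of $\mathbb{R}$ of one-dimensional Lebesgue measure zero. 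-/

import Mathlib

open MeasureTheory Filter
open scoped OnePoint ENNReal

noncomputable section

namespace PQModel

/-! ### The random walk, the Laplacian and the symmetrizing measure -/

/-- The residue modulo 3 (which is 1 or 2 if `x ≠ 0`) of `3 ^ (-m(x)) * x`, where `m(x)` is the
largest `m` such that `3 ^ m` divides `x`. -/
def lastDigit (x : ℕ) : ℕ := (x / 3 ^ padicValNat 3 x) % 3

/-- Transition probability from `x` to `x + 1`. -/
def up (p : ℝ) (x : ℕ) : ℝ :=
  if x = 0 then 1 else if lastDigit x = 1 then p else 1 - p

/-- Transition probability from `x` to `x - 1` (zero at the origin). -/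
def down (p : ℝ) (x : ℕ) : ℝ :=
  if x = 0 then 0 else if lastDigit x = 1 then 1 - p else p

/-- The Laplacian `Δ_p` on all functions on `ℤ₊ = {0, 1, 2, …}`: it is `f 0 - f 1` at the
origin, `f x - q f (x-1) - p f (x+1)` if `lastDigit x = 1`, and
`f x - p f (x-1) - q f (x+1)` if `lastDigit x = 2`, where `q = 1 - p`. At `x = 0` the
coefficient of `f (x - 1)` vanishes. -/
def laplacian (p : ℝ) (f : ℕ → ℂ) (x : ℕ) : ℂ :=
  f x - (down p x : ℂ) * f (x - 1) - (up p x : ℂ) * f (x + 1)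

/-- The density of the symmetrizing (reversible, invariant) measure of the walk, obtained by
iteratively solving the detailed balance equations; the normalization is `π(0) = 1`. -/
def weight (p : ℝ) : ℕ → ℝ
  | 0 => 1
  | x + 1 => weight p x * up p x / down p (x + 1)

/-- Detailed balance: `π(x) p(x,x+1) = π(x+1) p(x+1,x)`. -/
theorem weight_reversible {p : ℝ} (hp0 : 0 < p) (hp1 : p < 1) (x : ℕ) :
    weight p x * up p x = weight p (x + 1) * down p (x + 1) := by
  have h : down p (x + 1) ≠ 0 := by
    rw [down, if_neg (Nat.succ_ne_zero x)]
    split_ifs <;> linarith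
  rw [weight, div_mul_cancel₀ _ h]

/-- The symmetrizing measure `π` on `ℤ₊`. -/
def piMeasure (p : ℝ) : Measure ℕ :=
  Measure.sum fun x => ENNReal.ofReal (weight p x) • Measure.dirac x

/-- The complex Hilbert space `ℓ²(ℤ₊)`. -/
abbrev Ell2 : Type := lp (fun _ : ℕ => ℂ) 2

/-- The complex Hilbert space `L²(ℤ₊, π)`. Every point has positive `π`-measure if `0 < p < 1`,
so that its elements are genuine functions. -/
abbrev L2pi (p : ℝ) : Type := Lp ℂ 2 (piMeasure p)

/-- The bounded operator `T` on `ℓ²(ℤ₊)` is `Δ_p`. This determines `T`. -/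
def IsLaplacianEll2 (p : ℝ) (T : Ell2 →L[ℂ] Ell2) : Prop :=
  ∀ (f : Ell2) (x : ℕ), (T f : ℕ → ℂ) x = laplacian p (f : ℕ → ℂ) x

/-- The bounded operator `T` on `L²(ℤ₊, π)` is `Δ_p`. This determines `T`. -/
def IsLaplacianL2pi (p : ℝ) (T : L2pi p →L[ℂ] L2pi p) : Prop :=
  ∀ (f : L2pi p) (x : ℕ), (T f : ℕ → ℂ) x = laplacian p (f : ℕ → ℂ) x

/-! ### Spectral types -/

section Spectral

variable {H : Type*} [NormedAddCommGroup H] [InnerProductSpace ℂ H] [CompleteSpace H]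

/-- A measure on the line is singularly continuous: it has no atoms and it is singular with
respect to Lebesgue measure. -/
def IsSingularContinuous (μ : Measure ℝ) : Prop :=
  (∀ t : ℝ, μ {t} = 0) ∧ μ ⟂ₘ (volume : Measure ℝ)

/-- `μ` is the spectral measure of the bounded self-adjoint operator `T` at the vector `f`:
a finite Borel measure with `⟪f, g(T) f⟫ = ∫ g dμ` for all continuous `g`, where `g(T)` is given by
the continuous functional calculus. -/
def IsSpectralMeasure (T : H →L[ℂ] H) (f : H) (μ : Measure ℝ) : Prop :=
  IsFiniteMeasure μ ∧
    ∀ g : ℝ → ℝ, Continuous g → inner ℂ f ((cfc g T : H →L[ℂ] H) f) = ((∫ t, g t ∂μ : ℝ) : ℂ)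

/-- A bounded self-adjoint operator with purely singularly continuous spectrum: every vector has
a spectral measure (it is unique), and this measure is singularly continuous. -/
def HasPurelySCSpectrum (T : H →L[ℂ] H) : Prop :=
  IsSelfAdjoint T ∧ ∀ f : H, ∃ μ : Measure ℝ, IsSpectralMeasure T f μ ∧ IsSingularContinuous μ

/-- The operator has neither eigenvalues nor residual spectrum: the spectrum consists of
continuous spectrum only. -/
def HasPurelyContinuousSpectrum (T : H →L[ℂ] H) : Prop :=
  ∀ z ∈ spectrum ℂ T, Function.Injective (T - algebraMap ℂ (H →L[ℂ] H) z) ∧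
    DenseRange (T - algebraMap ℂ (H →L[ℂ] H) z)

/-- The spectrum is a subset of the real line, and its one-dimensional Lebesgue measure is 0. -/
def HasNullRealSpectrum (T : H →L[ℂ] H) : Prop :=
  (∀ z ∈ spectrum ℂ T, z.im = 0) ∧ volume {t : ℝ | (t : ℂ) ∈ spectrum ℂ T} = 0

end Spectral

/-- The difference `μ - ν` of two finite measures that live on the spectrum of `T` represents the
matrix entries at `(x, y)` of the powers of `T`: `(T ^ n δ_y)(x) = ∫ t ^ n d(μ - ν)(t)`
for all `n`. -/
def RepresentsEntry (T : Ell2 →L[ℂ] Ell2) (x y : ℕ) (μ ν : Measure ℝ) : Prop :=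
  IsFiniteMeasure μ ∧ IsFiniteMeasure ν ∧
    μ {t : ℝ | (t : ℂ) ∉ spectrum ℂ T} = 0 ∧ ν {t : ℝ | (t : ℂ) ∉ spectrum ℂ T} = 0 ∧
    ∀ n : ℕ, ((T ^ n) (lp.single 2 y (1 : ℂ)) : ℕ → ℂ) x =
      ((∫ t, t ^ n ∂μ - ∫ t, t ^ n ∂ν : ℝ) : ℂ)

/-- Purely singularly continuous spectrum for an operator on `ℓ²(ℤ₊)` that need not be
self-adjoint: the spectrum is a Lebesgue null subset of the line, it is purely continuous,
and all the spectral measures of matrix entries exist and are singularly continuous. -/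
def HasPurelySCSpectrumEll2 (T : Ell2 →L[ℂ] Ell2) : Prop :=
  HasNullRealSpectrum T ∧ HasPurelyContinuousSpectrum T ∧
    ∀ x y : ℕ, ∃ μ ν : Measure ℝ, RepresentsEntry T x y μ ν ∧
      IsSingularContinuous μ ∧ IsSingularContinuous ν

/-! ### Julia sets on the Riemann sphere -/

/-- The chordal distance on the Riemann sphere `ℂ ∪ {∞}`. -/
def chordalDist : OnePoint ℂ → OnePoint ℂ → ℝ
  | ∞, ∞ => 0
  | ∞, OnePoint.some w => 2 / √(1 + ‖w‖ ^ 2)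
  | OnePoint.some z, ∞ => 2 / √(1 + ‖z‖ ^ 2)
  | OnePoint.some z, OnePoint.some w => 2 * ‖z - w‖ / (√(1 + ‖z‖ ^ 2) * √(1 + ‖w‖ ^ 2))

/-- The iterates of `F` form a normal family on `U`: every sequence of iterates has a subsequence
which converges (to some map into the sphere) uniformly on compact subsets of `U`. -/
def NormalIterates (F : OnePoint ℂ → OnePoint ℂ) (U : Set (OnePoint ℂ)) : Prop :=
  ∀ k : ℕ → ℕ, ∃ φ : ℕ → ℕ, StrictMono φ ∧ ∃ G : OnePoint ℂ → OnePoint ℂ,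
    ∀ K : Set (OnePoint ℂ), K ⊆ U → IsCompact K → ∀ ε : ℝ, 0 < ε →
      ∀ᶠ n in atTop, ∀ z ∈ K, chordalDist (F^[k (φ n)] z) (G z) < ε

/-- The Fatou set: the points with a neighbourhood on which the iterates form a normal family. -/
def fatouSet (F : OnePoint ℂ → OnePoint ℂ) : Set (OnePoint ℂ) :=
  {z | ∃ U : Set (OnePoint ℂ), IsOpen U ∧ z ∈ U ∧ NormalIterates F U}

/-- The Julia set: the complement of the Fatou set in the sphere. -/
def juliaSet (F : OnePoint ℂ → OnePoint ℂ) : Set (OnePoint ℂ) := (fatouSet F)ᶜ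

/-- The cubic polynomial `R(z) = z (z² - 3 z + 2 + p q) / (p q)` with `q = 1 - p`. -/
def cubic (p : ℝ) (z : ℂ) : ℂ :=
  z * (z ^ 2 - 3 * z + 2 + (p : ℂ) * (1 - (p : ℂ))) / ((p : ℂ) * (1 - (p : ℂ)))

/-- The Julia set of `R`, as a map of the sphere which fixes `∞`. -/
def cubicJulia (p : ℝ) : Set (OnePoint ℂ) := juliaSet (OnePoint.map (cubic p))

end PQModel

end

/-! The proof rests on spectral decimation. Eliminating the sites outside `3ℤ₊` from `Δ_p - z`
leaves, by self-similarity, a multiple of `Δ_p - R(z)` (`schur_complement`). Hence `z` and `R(z)`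
lie in the spectrum together unless `(1 - z)² = p²`. The two exceptional values `1 ± p` are sent to
the fixed points `0` and `2` of `R`, so a spectral point has a bounded orbit under `R`. Conversely,
the spectrum is closed and contains the full backward orbit of some point other than `0` and `2`.
The argument uses only that the weight is invariant under `x ↦ 3x` and comparable at neighbours, so
it covers `ℓ²` and `L²(π)` at once.

In the coordinate `z - 1`, the map `R` becomes `x + x(x² - 1)/c` with `c = pq`, a perturbation of
the Chebyshev cubic, which is the case `c = 1/4`. The sum of the distances to `±1` satisfies
`E(g(w)) - 2 ≥ 9(E(w) - 2)` for the perturbed map `g`, so every orbit escapes to infinity unless it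
stays in `[-1, 1]`. The Julia set is therefore the set of trapped real points. Three monotone
branches onto `[-1, 1]`, together with a metric expanded by a factor larger than 3, make this set
Lebesgue null (`volume_trappedSet`). Nullity forces points with equal itineraries to coincide, so
the set is a full shift on three symbols, a Cantor set in which backward orbits are dense.

A square summable eigenfunction `f` would satisfy `f(3ⁿx) → 0`, which contradicts the renormalized
equations at `0` and `1` (`eq_zero_of_eigen`). In `L²(π)`, spectral measures thus have no atoms, and
they live on a null set, so they are singularly continuous. On `ℓ²`, an eigenvector of the adjoint
is `π` times an eigenfunction, which excludes residual spectrum, and matrix entries are obtained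
from `L²(π)` by polarization. -/

/-! ### Coding by itineraries -/

section Coding

open Topology

variable {X A : Type*}

/-- The itinerary of a point under `step`, read off by `sym`. -/
def itinerary (sym : X → A) (step : X → X) (x : X) (n : ℕ) : A := sym (step^[n] x)

/-- Every finite word can be prepended to the itinerary of a point. -/
theorem exists_itinerary_prefix {sym : X → A} {step : X → X}
    (hpre : ∀ a x, ∃ y, sym y = a ∧ step y = x) (s : ℕ → A) (x : X) (n : ℕ) :
    ∃ y, step^[n] y = x ∧ ∀ k < n, itinerary sym step y k = s k := by
  induction n generalizing s with
  | zero => exact ⟨x, rfl, fun k hk => absurd hk (Nat.not_lt_zero k)⟩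
  | succ n ih =>
    obtain ⟨y, hy, hys⟩ := ih (fun k => s (k + 1))
    obtain ⟨u, hu, hu'⟩ := hpre (s 0) y
    refine ⟨u, by rw [Function.iterate_succ_apply, hu', hy], fun k hk => ?_⟩
    cases k with
    | zero => exact hu
    | succ k =>
      rw [itinerary, Function.iterate_succ_apply, hu']
      exact hys k (by omega)

variable [TopologicalSpace X] [TopologicalSpace A]

theorem tendsto_of_eventually_eq_coord {u : ℕ → ℕ → A} {s : ℕ → A}
    (h : ∀ n, ∀ k < n, u n k = s k) : Tendsto u atTop (𝓝 s) := by
  rw [tendsto_pi_nhds]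
  intro k
  refine tendsto_const_nhds.congr' ?_
  filter_upwards [eventually_gt_atTop k] with n hn
  exact (h n k hn).symm

theorem continuous_itinerary {sym : X → A} {step : X → X} (hsym : Continuous sym)
    (hstep : Continuous step) : Continuous (itinerary sym step) :=
  continuous_pi fun n => hsym.comp (hstep.iterate n)

variable [DiscreteTopology A]

/-- Surjectivity is a compactness argument: the range is closed, and every sequence is a limit of
itineraries that agree with it on longer and longer prefixes. -/
theorem bijective_itinerary [CompactSpace X] [Nonempty X] {sym : X → A} {step : X → X}
    (hsym : Continuous sym) (hstep : Continuous step)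
    (hpre : ∀ a x, ∃ y, sym y = a ∧ step y = x)
    (hinj : Function.Injective (itinerary sym step)) :
    Function.Bijective (itinerary sym step) := by
  refine ⟨hinj, fun s => ?_⟩
  have hcl : IsClosed (Set.range (itinerary sym step)) :=
    (isCompact_range (continuous_itinerary hsym hstep)).isClosed
  choose u _ hu using exists_itinerary_prefix hpre s (Classical.arbitrary X)
  exact hcl.mem_of_tendsto (tendsto_of_eventually_eq_coord hu)
    (Eventually.of_forall fun n => Set.mem_range_self _)

/-- A compact dynamical system with a full itinerary coding is homeomorphic to the full shift. -/
noncomputable def itineraryHomeomorph [CompactSpace X] [Nonempty X] {sym : X → A} {step : X → X}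
    (hsym : Continuous sym) (hstep : Continuous step)
    (hpre : ∀ a x, ∃ y, sym y = a ∧ step y = x)
    (hinj : Function.Injective (itinerary sym step)) : X ≃ₜ (ℕ → A) :=
  Continuous.homeoOfEquivCompactToT2
    (f := Equiv.ofBijective _ (bijective_itinerary hsym hstep hpre hinj))
    (continuous_itinerary hsym hstep)

/-- In a fully coded compact system all backward orbits are dense. -/
theorem exists_backward_orbit_tendsto [CompactSpace X] {sym : X → A} {step : X → X}
    (hsym : Continuous sym) (hstep : Continuous step)
    (hpre : ∀ a x, ∃ y, sym y = a ∧ step y = x)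
    (hinj : Function.Injective (itinerary sym step)) (x y : X) :
    ∃ u : ℕ → X, (∀ n, step^[n] (u n) = x) ∧ Tendsto u atTop (𝓝 y) := by
  have : Nonempty X := ⟨x⟩
  choose u hu hus using exists_itinerary_prefix hpre (itinerary sym step y) x
  refine ⟨u, hu, ?_⟩
  -- Under the homeomorphism with the shift space, agreement on growing prefixes becomes
  -- convergence.
  let e := itineraryHomeomorph hsym hstep hpre hinj
  have h : Tendsto (fun n => e (u n)) atTop (𝓝 (e y)) := tendsto_of_eventually_eq_coord hus
  have h' := (e.symm.continuous.tendsto _).comp h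
  rw [e.symm_apply_apply] at h'
  exact h'.congr fun n => e.symm_apply_apply (u n)

/-- Drop the first code word of the prefix code `0, 10, 11`. -/
def dropCodeWord (s : ℕ → Bool) : ℕ → Bool :=
  bif s 0 then fun n => s (n + 2) else fun n => s (n + 1)

/-- The first code word of the prefix code `0, 10, 11`. -/
def firstCodeWord (s : ℕ → Bool) : Fin 3 :=
  bif s 0 then (bif s 1 then 2 else 1) else 0

theorem continuous_dropCodeWord : Continuous dropCodeWord := by
  refine continuous_pi fun n => ?_
  have h : (fun s : ℕ → Bool => dropCodeWord s n) =
      (fun t : Bool × Bool × Bool => bif t.1 then t.2.1 else t.2.2) ∘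
        fun s => (s 0, s (n + 2), s (n + 1)) := by
    ext s
    simp only [dropCodeWord, Function.comp_apply]
    cases s 0 <;> rfl
  rw [h]
  exact continuous_of_discreteTopology.comp (by fun_prop)

theorem continuous_firstCodeWord : Continuous firstCodeWord := by
  have h : firstCodeWord =
      (fun t : Bool × Bool => bif t.1 then (bif t.2 then (2 : Fin 3) else 1) else 0) ∘
        fun s : ℕ → Bool => (s 0, s 1) := rfl
  rw [h]
  exact continuous_of_discreteTopology.comp (by fun_prop)

theorem exists_prepend_codeWord (a : Fin 3) (s : ℕ → Bool) :
    ∃ t, firstCodeWord t = a ∧ dropCodeWord t = s := by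
  fin_cases a
  · exact ⟨fun n => Nat.casesOn n false s, rfl, rfl⟩
  · exact ⟨fun n => Nat.casesOn n true fun n => Nat.casesOn n false s, rfl, rfl⟩
  · exact ⟨fun n => Nat.casesOn n true fun n => Nat.casesOn n true s, rfl, rfl⟩

/-- A prefix code is uniquely decodable. Removing a code word shifts positions by 1 or 2, so the
induction on the position to be recovered is a strong one, over all pairs of sequences. -/
theorem injective_itinerary_codeWord :
    Function.Injective (itinerary firstCodeWord dropCodeWord) := by
  have key : ∀ n : ℕ, ∀ s t : ℕ → Bool,
      itinerary firstCodeWord dropCodeWord s = itinerary firstCodeWord dropCodeWord t →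
      s n = t n := by
    intro n
    induction n using Nat.strong_induction_on with
    | _ n ih =>
      intro s t h
      have h0 : firstCodeWord s = firstCodeWord t := congrFun h 0
      have hd : itinerary firstCodeWord dropCodeWord (dropCodeWord s) =
          itinerary firstCodeWord dropCodeWord (dropCodeWord t) := by
        ext1 k
        have := congrFun h (k + 1)
        simpa only [itinerary, Function.iterate_succ_apply] using this
      rcases hs : s 0 with _ | _ <;> rcases ht : t 0 with _ | _
      · rcases n with _ | n
        · rw [hs, ht]
        · have := ih n (by omega) _ _ hd
          simpa [dropCodeWord, hs, ht] using this
      · exfalso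
        simp only [firstCodeWord, hs, ht] at h0
        cases ht1 : t 1 <;> simp [ht1] at h0
      · exfalso
        simp only [firstCodeWord, hs, ht] at h0
        cases hs1 : s 1 <;> simp [hs1] at h0
      · rcases n with _ | _ | n
        · rw [hs, ht]
        · simp only [firstCodeWord, hs, ht] at h0
          cases hs1 : s 1 <;> cases ht1 : t 1 <;> simp_all
        · have := ih n (by omega) _ _ hd
          simpa [dropCodeWord, hs, ht] using this
  exact fun s t h => funext fun n => key n s t h

/-- The ternary and the binary sequence spaces are homeomorphic. -/
noncomputable def natToBoolHomeomorphNatToFinThree : (ℕ → Bool) ≃ₜ (ℕ → Fin 3) :=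
  itineraryHomeomorph continuous_firstCodeWord continuous_dropCodeWord exists_prepend_codeWord
    injective_itinerary_codeWord

end Coding

/-! ### The cubic on the real line -/

section RealDynamics

open Topology Set

/-- The cubic `x + x (x² - 1) / c`, with fixed points `-1`, `0` and `1`. -/
def centeredCubic {F : Type*} [Field F] (c x : F) : F := x + x * (x ^ 2 - 1) / c

theorem continuous_centeredCubic {F : Type*} [NormedField F] (c : F) :
    Continuous (centeredCubic c) := by
  unfold centeredCubic
  fun_prop

/-- The real points whose orbit stays in `[-1, 1]`. -/
def trappedSet (c : ℝ) : Set ℝ := {x | ∀ n, (centeredCubic c)^[n] x ∈ Icc (-1) 1}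

theorem isCompact_trappedSet (c : ℝ) : IsCompact (trappedSet c) := by
  have hcl : IsClosed (trappedSet c) := by
    rw [trappedSet, ofPred_forall]
    exact isClosed_iInter fun n =>
      isClosed_Icc.preimage ((continuous_centeredCubic c).iterate n)
  exact isCompact_Icc.of_isClosed_subset hcl fun x hx => hx 0

theorem mem_trappedSet_iff {c x : ℝ} :
    x ∈ trappedSet c ↔ x ∈ Icc (-1) 1 ∧ centeredCubic c x ∈ trappedSet c := by
  refine ⟨fun h => ⟨h 0, fun n => ?_⟩, fun h n => ?_⟩
  · have := h (n + 1)
    rwa [Function.iterate_succ_apply] at this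
  · cases n with
    | zero => exact h.1
    | succ n =>
      rw [Function.iterate_succ_apply]
      exact h.2 n

theorem iterate_mem_trappedSet {c x : ℝ} (hx : x ∈ trappedSet c) (n : ℕ) :
    (centeredCubic c)^[n] x ∈ trappedSet c := by
  induction n with
  | zero => exact hx
  | succ n ih =>
    rw [Function.iterate_succ_apply']
    exact (mem_trappedSet_iff.1 ih).2

/-- The three intervals which make up the preimage of `[-1, 1]`. -/
def laminarPiece (a b : ℝ) : Fin 3 → Set ℝ := ![Icc (-1) (-b), Icc (-a) a, Icc b 1]

/-- The index of the piece containing a point, cut off at `± 1 / 2`. -/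
noncomputable def pieceIndex (x : ℝ) : Fin 3 := if x < -(1 / 2) then 0 else if x < 1 / 2 then 1 else 2

variable {a b : ℝ}

/-- Writing `c = ab` with `a + b = 1` exposes the preimages `1, -a, -b` of `1`; the companion lemma
does the same for `-1`. All later facts about the real branches are read off from these two
factorizations. -/
theorem one_sub_centeredCubic (ha : 0 < a) (hab : a < b) (h1 : a + b = 1) (x : ℝ) :
    1 - centeredCubic (a * b) x = (1 - x) * (x + a) * (x + b) / (a * b) := by
  have hb : 0 < b := ha.trans hab
  obtain rfl : b = 1 - a := by linarith
  have := hb.ne'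
  unfold centeredCubic
  field_simp
  ring

theorem one_add_centeredCubic (ha : 0 < a) (hab : a < b) (h1 : a + b = 1) (x : ℝ) :
    1 + centeredCubic (a * b) x = (1 + x) * (x - a) * (x - b) / (a * b) := by
  have hb : 0 < b := ha.trans hab
  obtain rfl : b = 1 - a := by linarith
  have := hb.ne'
  unfold centeredCubic
  field_simp
  ring

theorem laminarPiece_subset (ha : 0 < a) (hab : a < b) (h1 : a + b = 1) (i : Fin 3) :
    laminarPiece a b i ⊆ Icc (-1) 1 := by
  intro x hx
  fin_cases i <;> simp only [laminarPiece, Fin.zero_eta, Fin.mk_one, Fin.reduceFinMk,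
    Matrix.cons_val, mem_Icc] at hx ⊢ <;> constructor <;> linarith [hx.1, hx.2]

theorem pieceIndex_eq (ha : 0 < a) (hab : a < b) (h1 : a + b = 1) {i : Fin 3} {x : ℝ}
    (hx : x ∈ laminarPiece a b i) : pieceIndex x = i := by
  unfold pieceIndex
  fin_cases i <;> simp only [laminarPiece, Fin.zero_eta, Fin.mk_one, Fin.reduceFinMk,
    Matrix.cons_val, mem_Icc] at hx ⊢
  · rw [if_pos (by linarith)]
  · rw [if_neg (by linarith), if_pos (by linarith)]
  · rw [if_neg (by linarith), if_neg (by linarith)]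

/-- In each gap between the pieces one of the two factorized cubics is negative, so the image would
leave `[-1, 1]`. -/
theorem mem_laminarPiece (ha : 0 < a) (hab : a < b) (h1 : a + b = 1) {x : ℝ}
    (hx : x ∈ Icc (-1) 1) (hfx : centeredCubic (a * b) x ∈ Icc (-1) 1) :
    x ∈ laminarPiece a b (pieceIndex x) := by
  have hb : 0 < b := ha.trans hab
  have hc : 0 < a * b := mul_pos ha hb
  have hm : 0 ≤ (1 - x) * (x + a) * (x + b) := by
    have := one_sub_centeredCubic ha hab h1 x
    rw [eq_div_iff hc.ne'] at this
    rw [← this]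
    exact mul_nonneg (by linarith [hfx.2]) hc.le
  have hp : 0 ≤ (1 + x) * (x - a) * (x - b) := by
    have := one_add_centeredCubic ha hab h1 x
    rw [eq_div_iff hc.ne'] at this
    rw [← this]
    exact mul_nonneg (by linarith [hfx.1]) hc.le
  obtain ⟨hx1, hx2⟩ := hx
  unfold pieceIndex
  split_ifs with h h' <;> simp only [laminarPiece, Matrix.cons_val, mem_Icc]
  · refine ⟨hx1, ?_⟩
    by_contra! hlt
    have : (1 - x) * (x + a) * (x + b) < 0 :=
      mul_neg_of_neg_of_pos (mul_neg_of_pos_of_neg (by linarith) (by linarith)) (by linarith)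
    linarith
  · constructor
    · by_contra! hlt
      have : (1 - x) * (x + a) * (x + b) < 0 :=
        mul_neg_of_neg_of_pos (mul_neg_of_pos_of_neg (by linarith) (by linarith)) (by linarith)
      linarith
    · by_contra! hlt
      have : (1 + x) * (x - a) * (x - b) < 0 :=
        mul_neg_of_pos_of_neg (mul_pos (by linarith) (by linarith)) (by linarith)
      linarith
  · refine ⟨?_, hx2⟩
    by_contra! hlt
    have : (1 + x) * (x - a) * (x - b) < 0 :=
      mul_neg_of_pos_of_neg (mul_pos (by linarith) (by linarith)) (by linarith)
    linarith

theorem centeredCubic_sub (c x y : ℝ) (hc : c ≠ 0) :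
    centeredCubic c y - centeredCubic c x =
      (y - x) * ((x ^ 2 + x * y + y ^ 2 - 1 + c) / c) := by
  unfold centeredCubic
  field_simp
  ring

/-- The difference quotient is `(x² + xy + y² - 1 + c)/c`. Its numerator is at least `(2b - 1)(b +
1) > 0` on the outer pieces and at most `(2a - 1)(a + 1) < 0` on the middle one, because `a < 1/2 <
b`. -/
theorem strictMonoOn_or_strictAntiOn_laminarPiece (ha : 0 < a) (hab : a < b) (h1 : a + b = 1)
    (i : Fin 3) : StrictMonoOn (centeredCubic (a * b)) (laminarPiece a b i) ∨
      StrictAntiOn (centeredCubic (a * b)) (laminarPiece a b i) := by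
  have hb : 0 < b := ha.trans hab
  have hc : 0 < a * b := mul_pos ha hb
  have hmono : ∀ x y : ℝ, x < y → 3 * b ^ 2 ≤ x ^ 2 + x * y + y ^ 2 →
      centeredCubic (a * b) x < centeredCubic (a * b) y := by
    intro x y hxy hq
    rw [← sub_pos, centeredCubic_sub _ _ _ hc.ne']
    refine mul_pos (by linarith) (div_pos ?_ hc)
    obtain rfl : a = 1 - b := by linarith
    nlinarith
  fin_cases i <;> simp only [laminarPiece, Fin.zero_eta, Fin.mk_one, Fin.reduceFinMk,
    Matrix.cons_val]
  · left
    intro x hx y hy hxy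
    refine hmono x y hxy ?_
    have h1 := hx.2
    have h2 := hy.2
    nlinarith
  · right
    intro x hx y hy hxy
    rw [← sub_neg, centeredCubic_sub _ _ _ hc.ne']
    refine mul_neg_of_pos_of_neg (by linarith) (div_neg_of_neg_of_pos ?_ hc)
    have h2 : x ^ 2 ≤ a ^ 2 := sq_le_sq' hx.1 hx.2
    have h3 : y ^ 2 ≤ a ^ 2 := sq_le_sq' hy.1 hy.2
    obtain rfl : b = 1 - a := by linarith
    nlinarith [sq_nonneg (x - y)]
  · left
    intro x hx y hy hxy
    refine hmono x y hxy ?_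
    have h1 := hx.1
    have h2 := hy.1
    nlinarith

theorem injOn_laminarPiece (ha : 0 < a) (hab : a < b) (h1 : a + b = 1) (i : Fin 3) :
    InjOn (centeredCubic (a * b)) (laminarPiece a b i) :=
  (strictMonoOn_or_strictAntiOn_laminarPiece ha hab h1 i).elim (·.injOn) (·.injOn)

theorem exists_mem_laminarPiece (ha : 0 < a) (hab : a < b) (h1 : a + b = 1) (i : Fin 3) {y : ℝ}
    (hy : y ∈ Icc (-1) 1) : ∃ x ∈ laminarPiece a b i, centeredCubic (a * b) x = y := by
  have hcont := (continuous_centeredCubic (a * b))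
  have hm := one_sub_centeredCubic ha hab h1
  have hp := one_add_centeredCubic ha hab h1
  have e1 : centeredCubic (a * b) (-1) = -1 := by have := hp (-1); norm_num at this; linarith
  have e2 : centeredCubic (a * b) (-b) = 1 := by have := hm (-b); norm_num at this; linarith
  have e3 : centeredCubic (a * b) (-a) = 1 := by have := hm (-a); norm_num at this; linarith
  have e4 : centeredCubic (a * b) a = -1 := by have := hp a; norm_num at this; linarith
  have e5 : centeredCubic (a * b) b = -1 := by have := hp b; norm_num at this; linarith
  have e6 : centeredCubic (a * b) 1 = 1 := by have := hm 1; norm_num at this; linarith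
  fin_cases i <;> simp only [laminarPiece, Fin.zero_eta, Fin.mk_one, Fin.reduceFinMk,
    Matrix.cons_val]
  · refine intermediate_value_Icc (by linarith) hcont.continuousOn ?_
    rwa [e1, e2]
  · refine intermediate_value_Icc' (by linarith) hcont.continuousOn ?_
    rwa [e3, e4]
  · refine intermediate_value_Icc (by linarith) hcont.continuousOn ?_
    rwa [e5, e6]

theorem image_trappedSet_inter (ha : 0 < a) (hab : a < b) (h1 : a + b = 1) (i : Fin 3) :
    centeredCubic (a * b) '' (trappedSet (a * b) ∩ laminarPiece a b i) = trappedSet (a * b) := by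
  ext y
  constructor
  · rintro ⟨x, ⟨hx, -⟩, rfl⟩
    exact (mem_trappedSet_iff.1 hx).2
  · intro hy
    obtain ⟨x, hx, rfl⟩ := exists_mem_laminarPiece ha hab h1 i (hy 0)
    exact ⟨x, ⟨mem_trappedSet_iff.2 ⟨laminarPiece_subset ha hab h1 i hx, hy⟩, hx⟩, rfl⟩

theorem hasDerivAt_centeredCubic (c x : ℝ) :
    HasDerivAt (centeredCubic c) (1 + (3 * x ^ 2 - 1) / c) x := by
  have h := (hasDerivAt_id x).add
    (((hasDerivAt_id x).mul (((hasDerivAt_id x).pow 2).sub_const 1)).div_const c)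
  refine h.congr_deriv ?_
  simp
  ring

/-- The cubic expands the metric `|dx| / √(A² - x²)` on `[-1, 1]` by more than the factor 3 if
`A² = 1 + (1 - 4 c) / 2`. -/
theorem three_div_sqrt_lt {c x : ℝ} (hc : 0 < c) (hc4 : c < 1 / 4)
    (hx : x ∈ Icc (-1) 1) (hfx : centeredCubic c x ∈ Icc (-1) 1) :
    3 * (1 / √(1 + (1 - 4 * c) / 2 - x ^ 2)) <
      |1 + (3 * x ^ 2 - 1) / c| * (1 / √(1 + (1 - 4 * c) / 2 - centeredCubic c x ^ 2)) := by
  have hx2 : x ^ 2 ≤ 1 := (sq_le_one_iff_abs_le_one x).2 (abs_le.2 hx)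
  have hf2 : centeredCubic c x ^ 2 ≤ 1 := (sq_le_one_iff_abs_le_one _).2 (abs_le.2 hfx)
  have key : 9 * (1 + (1 - 4 * c) / 2 - centeredCubic c x ^ 2) <
      (1 + (3 * x ^ 2 - 1) / c) ^ 2 * (1 + (1 - 4 * c) / 2 - x ^ 2) := by
    have hu0 : 0 ≤ x ^ 2 := sq_nonneg x
    -- The factor `1 - 4c` measures the distance to the Chebyshev case, where the arcsine metric is
    -- expanded by exactly 3. The choice of `A²` keeps the remaining factor positive on `[0, 1]` in
    -- the variable `x²`.
    have hid : (1 + (3 * x ^ 2 - 1) / c) ^ 2 * (1 + (1 - 4 * c) / 2 - x ^ 2) -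
        9 * (1 + (1 - 4 * c) / 2 - centeredCubic c x ^ 2) =
        (1 - 4 * c) * ((1 - x ^ 2) * (3 * x ^ 2 + 1 + 2 * c) +
          (3 * x ^ 2 - 1 - 2 * c) * (3 * x ^ 2 - 1 + 4 * c) / 2) / c ^ 2 := by
      unfold centeredCubic
      field_simp
      ring
    rw [← sub_pos, hid]
    generalize x ^ 2 = u at *
    refine div_pos (mul_pos (by linarith) ?_) (by positivity)
    nlinarith
  have hA : 0 < 1 + (1 - 4 * c) / 2 - x ^ 2 := by linarith
  have hB : 0 < 1 + (1 - 4 * c) / 2 - centeredCubic c x ^ 2 := by linarith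
  have hsqrt : 3 * √(1 + (1 - 4 * c) / 2 - centeredCubic c x ^ 2) <
      |1 + (3 * x ^ 2 - 1) / c| * √(1 + (1 - 4 * c) / 2 - x ^ 2) := by
    refine lt_of_pow_lt_pow_left₀ 2 (by positivity) ?_
    rw [mul_pow, mul_pow, Real.sq_sqrt hA.le, Real.sq_sqrt hB.le, sq_abs]
    linarith
  rw [mul_one_div, mul_one_div, div_lt_div_iff₀ (Real.sqrt_pos.2 hA) (Real.sqrt_pos.2 hB)]
  exact hsqrt

/-- Each of the three branches maps its part of the trapped set `K` onto `K`, so pulling back the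
density and summing gives exactly three times its integral. The pullback is strictly larger than
three times the density at every point of `K`, which is only possible if `K` is null. -/
theorem volume_trappedSet (ha : 0 < a) (hab : a < b) (h1 : a + b = 1) :
    volume (trappedSet (a * b)) = 0 := by
  have hb : 0 < b := ha.trans hab
  have hc : 0 < a * b := mul_pos ha hb
  have hc4 : a * b < 1 / 4 := by
    obtain rfl : b = 1 - a := by linarith
    nlinarith [mul_pos (sub_pos.2 hab) (sub_pos.2 hab)]
  set c := a * b with hcdef
  set K := trappedSet c with hK
  have hKm : MeasurableSet K := (isCompact_trappedSet c).isClosed.measurableSet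
  have hpos : ∀ x ∈ K, 0 < 1 + (1 - 4 * c) / 2 - x ^ 2 := fun x hx => by
    have : x ^ 2 ≤ 1 := (sq_le_one_iff_abs_le_one x).2 (abs_le.2 (hx 0))
    linarith
  set g : ℝ → ℝ := fun x => 1 / √(1 + (1 - 4 * c) / 2 - x ^ 2) with hg
  have hgc : ContinuousOn g K := by
    refine ContinuousOn.div continuousOn_const (by fun_prop) fun x hx => ?_
    exact (Real.sqrt_pos.2 (hpos x hx)).ne'
  set h : ℝ → ℝ := fun x => |1 + (3 * x ^ 2 - 1) / c| * g (centeredCubic c x) with hh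
  have hhc : ContinuousOn h K := by
    refine ContinuousOn.mul (by fun_prop) (hgc.comp
      (continuous_centeredCubic c).continuousOn fun x hx => (mem_trappedSet_iff.1 hx).2)
  have hgi : IntegrableOn g K := hgc.integrableOn_compact (isCompact_trappedSet c)
  have hhi : IntegrableOn h K := hhc.integrableOn_compact (isCompact_trappedSet c)
  have hpm : ∀ i, MeasurableSet (K ∩ laminarPiece a b i) := fun i => by
    refine hKm.inter ?_
    fin_cases i <;> exact measurableSet_Icc
  have hU : K = ⋃ i, K ∩ laminarPiece a b i := by
    rw [← inter_iUnion, eq_comm, inter_eq_left]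
    intro x hx
    exact mem_iUnion.2 ⟨_, mem_laminarPiece ha hab h1 (hx 0) (hx 1)⟩
  have hint : ∫ x in K, h x = 3 * ∫ x in K, g x := by
    have hpiece : ∀ i, ∫ x in K ∩ laminarPiece a b i, h x = ∫ x in K, g x := fun i => by
      have := integral_image_eq_integral_abs_deriv_smul (hpm i)
        (fun x _ => (hasDerivAt_centeredCubic c x).hasDerivWithinAt)
        ((injOn_laminarPiece ha hab h1 i).mono inter_subset_right) g
      rw [image_trappedSet_inter ha hab h1 i] at this
      exact this.symm
    calc ∫ x in K, h x = ∫ x in ⋃ i, K ∩ laminarPiece a b i, h x := by rw [← hU]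
      _ = ∑ i, ∫ x in K ∩ laminarPiece a b i, h x := by
        refine integral_iUnion_fintype hpm ?_ fun i => hhi.mono_set inter_subset_left
        intro i j hij
        refine Set.disjoint_left.2 fun x hxi hxj => hij ?_
        rw [← pieceIndex_eq ha hab h1 hxi.2, pieceIndex_eq ha hab h1 hxj.2]
      _ = 3 * ∫ x in K, g x := by simp [hpiece]
  have hlt : ∀ x ∈ K, 0 < h x - 3 * g x := fun x hx =>
    sub_pos.2 (three_div_sqrt_lt hc hc4 (hx 0) (hx 1))
  have hzero : ∫ x in K, (h x - 3 * g x) = 0 := by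
    rw [integral_sub hhi (hgi.const_mul 3), integral_const_mul, hint, sub_self]
  by_contra hne
  -- A function that is strictly positive on a set of positive measure has positive integral.
  have : 0 < ∫ x in K, (h x - 3 * g x) := by
    rw [setIntegral_pos_iff_support_of_nonneg_ae
      (ae_restrict_of_forall_mem hKm fun x hx => (hlt x hx).le) (hhi.sub (hgi.const_mul 3))]
    rw [inter_eq_right.2 fun x hx => Function.mem_support.2 (hlt x hx).ne']
    exact pos_iff_ne_zero.2 hne
  exact this.ne' hzero

/-- Points of the trapped set with the same itinerary coincide. -/
theorem eq_of_pieceIndex_eq (ha : 0 < a) (hab : a < b) (h1 : a + b = 1) {x y : ℝ}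
    (hx : x ∈ trappedSet (a * b)) (hy : y ∈ trappedSet (a * b))
    (h : ∀ n, pieceIndex ((centeredCubic (a * b))^[n] x) =
      pieceIndex ((centeredCubic (a * b))^[n] y)) : x = y := by
  wlog hxy : x ≤ y generalizing x y
  · exact (this hy hx (fun n => (h n).symm) (le_of_not_ge hxy)).symm
  by_contra hne
  have hlt : x < y := lt_of_le_of_ne hxy hne
  have hpiece : ∀ u ∈ trappedSet (a * b), ∀ n, (centeredCubic (a * b))^[n] u ∈
      laminarPiece a b (pieceIndex ((centeredCubic (a * b))^[n] u)) := fun u hu n => by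
    have hun := iterate_mem_trappedSet hu n
    exact mem_laminarPiece ha hab h1 (hun 0) (hun 1)
  -- At each time both orbits lie in the same piece, on which the map is monotone, so the orbits of
  -- all points between stay between them. The whole interval is trapped, and a null interval is a
  -- point.
  have hsub : Icc x y ⊆ trappedSet (a * b) := by
    have hstep : ∀ t ∈ Icc x y, ∀ n, (centeredCubic (a * b))^[n] t ∈
        uIcc ((centeredCubic (a * b))^[n] x) ((centeredCubic (a * b))^[n] y) := by
      intro t ht n
      induction n with
      | zero => exact Icc_subset_uIcc ht
      | succ n ih =>
        rw [Function.iterate_succ_apply', Function.iterate_succ_apply',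
          Function.iterate_succ_apply']
        have hxn := hpiece x hx n
        have hyn := hpiece y hy n
        rw [← h n] at hyn
        generalize pieceIndex ((centeredCubic (a * b))^[n] x) = i at hxn hyn
        have hconn : OrdConnected (laminarPiece a b i) := by
          fin_cases i <;> exact ordConnected_Icc
        have hsubset := hconn.uIcc_subset hxn hyn
        rcases strictMonoOn_or_strictAntiOn_laminarPiece ha hab h1 i with hm | hm
        · exact (hm.monotoneOn.mono hsubset).mapsTo_uIcc ih
        · exact (hm.antitoneOn.mono hsubset).mapsTo_uIcc ih
    exact fun t ht n => uIcc_subset_Icc (hx n) (hy n) (hstep t ht n)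
  have hvol := measure_mono_null hsub (volume_trappedSet ha hab h1)
  rw [Real.volume_Icc, ENNReal.ofReal_eq_zero] at hvol
  linarith

/-- The restriction of the cubic to its trapped set. -/
noncomputable def trappedStep (c : ℝ) (x : trappedSet c) : trappedSet c :=
  ⟨centeredCubic c x, (mem_trappedSet_iff.1 x.2).2⟩

theorem coe_iterate_trappedStep (c : ℝ) (n : ℕ) (x : trappedSet c) :
    (((trappedStep c)^[n] x : trappedSet c) : ℝ) = (centeredCubic c)^[n] x := by
  induction n with
  | zero => rfl
  | succ n ih => rw [Function.iterate_succ_apply', Function.iterate_succ_apply', ← ih]; rfl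

theorem continuous_trappedStep (c : ℝ) : Continuous (trappedStep c) :=
  ((continuous_centeredCubic c).comp continuous_subtype_val).subtype_mk _

/-- The cuts `± 1/2` fall into the gaps between the pieces, since `a < 1/2 < b`, so they split the
trapped set into clopen parts. -/
theorem continuous_pieceIndex_trappedSet (ha : 0 < a) (hab : a < b) (h1 : a + b = 1) :
    Continuous fun x : trappedSet (a * b) => pieceIndex x := by
  have hlt : ∀ r : ℝ, (∀ i, r ∉ laminarPiece a b i) →
      IsClopen {x : trappedSet (a * b) | (x : ℝ) < r} := by
    intro r hr
    refine ⟨?_, isOpen_lt continuous_subtype_val continuous_const⟩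
    have : {x : trappedSet (a * b) | (x : ℝ) < r} =
        {x : trappedSet (a * b) | (x : ℝ) ≤ r} := by
      ext x
      refine ⟨fun h => show (x : ℝ) ≤ r from le_of_lt h, fun h => show (x : ℝ) < r from lt_of_le_of_ne h fun h' => ?_⟩
      exact hr _ (h' ▸ mem_laminarPiece ha hab h1 (x.2 0) (x.2 1))
    rw [this]
    exact isClosed_le continuous_subtype_val continuous_const
  unfold pieceIndex
  refine continuous_const.if ?_ (continuous_const.if ?_ continuous_const)
  · intro x hx
    rw [(hlt (-(1 / 2)) fun i hi => ?_).frontier_eq] at hx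
    · exact hx.elim
    · fin_cases i <;> simp [laminarPiece] at hi <;> linarith
  · intro x hx
    rw [(hlt (1 / 2) fun i hi => ?_).frontier_eq] at hx
    · exact hx.elim
    · fin_cases i <;> simp [laminarPiece] at hi <;> linarith

theorem exists_trappedStep_eq (ha : 0 < a) (hab : a < b) (h1 : a + b = 1) (i : Fin 3)
    (y : trappedSet (a * b)) :
    ∃ x : trappedSet (a * b), pieceIndex x = i ∧ trappedStep (a * b) x = y := by
  obtain ⟨x, hx, hxy⟩ := exists_mem_laminarPiece ha hab h1 i (y.2 0)
  refine ⟨⟨x, mem_trappedSet_iff.2 ⟨laminarPiece_subset ha hab h1 i hx, ?_⟩⟩,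
    pieceIndex_eq ha hab h1 hx, Subtype.ext hxy⟩
  rw [hxy]
  exact y.2

theorem injective_itinerary_trappedSet (ha : 0 < a) (hab : a < b) (h1 : a + b = 1) :
    Function.Injective
      (itinerary (fun x : trappedSet (a * b) => pieceIndex x) (trappedStep (a * b))) := by
  intro x y h
  refine Subtype.ext (eq_of_pieceIndex_eq ha hab h1 x.2 y.2 fun n => ?_)
  have := congrFun h n
  simpa only [itinerary, coe_iterate_trappedStep] using this

/-- The trapped set is a Cantor set. -/
theorem nonempty_trappedSet_homeomorph_cantorSet (ha : 0 < a) (hab : a < b) (h1 : a + b = 1) :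
    Nonempty (trappedSet (a * b) ≃ₜ cantorSet) := by
  have : CompactSpace (trappedSet (a * b)) :=
    isCompact_iff_compactSpace.1 (isCompact_trappedSet _)
  have h0 : (0 : ℝ) ∈ trappedSet (a * b) := fun n => by
    have : centeredCubic (a * b) 0 = 0 := by simp [centeredCubic]
    rw [Function.iterate_fixed this]
    norm_num
  have : Nonempty (trappedSet (a * b)) := ⟨⟨0, h0⟩⟩
  exact ⟨((itineraryHomeomorph (continuous_pieceIndex_trappedSet ha hab h1)
    (continuous_trappedStep _) (exists_trappedStep_eq ha hab h1)
    (injective_itinerary_trappedSet ha hab h1)).trans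
    natToBoolHomeomorphNatToFinThree.symm).trans cantorSetHomeomorphNatToBool.symm⟩

theorem exists_tendsto_iterate_centeredCubic_eq (ha : 0 < a) (hab : a < b) (h1 : a + b = 1)
    {x y : ℝ} (hx : x ∈ trappedSet (a * b)) (hy : y ∈ trappedSet (a * b)) :
    ∃ u : ℕ → ℝ, (∀ n, (centeredCubic (a * b))^[n] (u n) = x) ∧ Tendsto u atTop (𝓝 y) := by
  have : CompactSpace (trappedSet (a * b)) :=
    isCompact_iff_compactSpace.1 (isCompact_trappedSet _)
  obtain ⟨u, hu, hlim⟩ := exists_backward_orbit_tendsto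
    (continuous_pieceIndex_trappedSet ha hab h1) (continuous_trappedStep _)
    (exists_trappedStep_eq ha hab h1) (injective_itinerary_trappedSet ha hab h1) ⟨x, hx⟩ ⟨y, hy⟩
  refine ⟨fun n => u n, fun n => ?_, (continuous_subtype_val.tendsto _).comp hlim⟩
  rw [← coe_iterate_trappedStep, hu]

end RealDynamics

/-! ### Escaping orbits in the complex plane -/

section ComplexDynamics

open Topology Set

theorem ofReal_centeredCubic (c x : ℝ) :
    ((centeredCubic c x : ℝ) : ℂ) = centeredCubic (c : ℂ) x := by
  simp [centeredCubic]

theorem ofReal_iterate_centeredCubic (c x : ℝ) (n : ℕ) :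
    (((centeredCubic c)^[n] x : ℝ) : ℂ) = (centeredCubic (c : ℂ))^[n] x := by
  induction n with
  | zero => rfl
  | succ n ih =>
    rw [Function.iterate_succ_apply', Function.iterate_succ_apply', ofReal_centeredCubic, ih]

/-- The sum of the distances to the foci `1` and `-1`. -/
noncomputable def fociSum (w : ℂ) : ℝ := ‖w - 1‖ + ‖w + 1‖

theorem continuous_fociSum : Continuous fociSum := by
  unfold fociSum
  fun_prop

theorem two_le_fociSum (w : ℂ) : 2 ≤ fociSum w := by
  have h := norm_sub_le (w + 1) (w - 1)
  have h2 : (w + 1) - (w - 1) = 2 := by ring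
  rw [h2, Complex.norm_ofNat] at h
  unfold fociSum
  linarith

theorem fociSum_le (w : ℂ) : fociSum w ≤ 2 * ‖w‖ + 2 := by
  have h1 := norm_sub_le w 1
  have h2 := norm_add_le w 1
  rw [norm_one] at h1 h2
  unfold fociSum
  linarith

theorem two_mul_norm_le_fociSum (w : ℂ) : 2 * ‖w‖ ≤ fociSum w := by
  have h := norm_add_le (w - 1) (w + 1)
  have h2 : (w - 1) + (w + 1) = 2 * w := by ring
  rwa [h2, norm_mul, Complex.norm_ofNat] at h

/-- The ellipse with foci `±1` and sum of distances 2 degenerates to the segment between the foci.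
-/
theorem eq_ofReal_of_fociSum_le {w : ℂ} (h : fociSum w ≤ 2) :
    w = (w.re : ℂ) ∧ w.re ∈ Icc (-1) 1 := by
  have h1 : |w.re - 1| ≤ ‖w - 1‖ := by simpa using Complex.abs_re_le_norm (w - 1)
  have h2 : |w.re + 1| ≤ ‖w + 1‖ := by simpa using Complex.abs_re_le_norm (w + 1)
  have h3 := le_abs_self (w.re + 1)
  have h4 := neg_le_abs (w.re - 1)
  have h5 := le_abs_self (w.re - 1)
  have h6 := neg_le_abs (w.re + 1)
  unfold fociSum at h
  refine ⟨?_, ?_, ?_⟩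
  · apply Complex.ext
    · simp
    · by_contra hne
      have h7 : |(w - 1).re| < ‖w - 1‖ := Complex.abs_re_lt_norm.2 (by simpa using hne)
      rw [Complex.sub_re, Complex.one_re] at h7
      linarith
  · linarith
  · linarith

/-- With `w = (ζ + 1/ζ)/2` the foci sum is `|ζ| + 1/|ζ|`, and the Chebyshev cubic becomes `ζ ↦ ζ³`.
The proof avoids `ζ` by using that this cubic takes the values `±1` with a double root each. -/
theorem fociSum_chebyshev (w : ℂ) :
    fociSum (4 * w ^ 3 - 3 * w) = fociSum w ^ 3 - 3 * fociSum w := by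
  have e1 : 4 * w ^ 3 - 3 * w - 1 = (w - 1) * (2 * w + 1) ^ 2 := by ring
  have e2 : 4 * w ^ 3 - 3 * w + 1 = (w + 1) * (2 * w - 1) ^ 2 := by ring
  have s2 : ‖w - 1‖ ^ 2 = (w.re - 1) ^ 2 + w.im ^ 2 := by
    rw [Complex.sq_norm, Complex.normSq_apply]; simp; ring
  have t2 : ‖w + 1‖ ^ 2 = (w.re + 1) ^ 2 + w.im ^ 2 := by
    rw [Complex.sq_norm, Complex.normSq_apply]; simp; ring
  have n1 : ‖2 * w + 1‖ ^ 2 = ‖w - 1‖ ^ 2 + 3 * ‖w + 1‖ ^ 2 - 3 := by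
    rw [s2, t2, Complex.sq_norm, Complex.normSq_apply]; simp; ring
  have n2 : ‖2 * w - 1‖ ^ 2 = 3 * ‖w - 1‖ ^ 2 + ‖w + 1‖ ^ 2 - 3 := by
    rw [s2, t2, Complex.sq_norm, Complex.normSq_apply]; simp; ring
  unfold fociSum
  rw [e1, e2, norm_mul, norm_mul, norm_pow, norm_pow, n1, n2]
  ring

variable {c : ℝ}

/-- The Chebyshev cubic at `w` is the convex combination of `g(w)` and `w` with weights `4c` and `1
- 4c`, where `g` is the centered cubic. Convexity of the foci sum transfers the exact Chebyshev
growth to `g`; the factor 9 is the derivative of `E³ - 3E` at `E = 2`. -/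
theorem nine_mul_fociSum_sub_two_le (hc : 0 < c) (hc4 : c ≤ 1 / 4) (w : ℂ) :
    9 * (fociSum w - 2) ≤ fociSum (centeredCubic (c : ℂ) w) - 2 := by
  have hcc : (c : ℂ) ≠ 0 := Complex.ofReal_ne_zero.2 hc.ne'
  have e : 4 * w ^ 3 - 3 * w =
      ((4 * c : ℝ) : ℂ) * centeredCubic (c : ℂ) w + ((1 - 4 * c : ℝ) : ℂ) * w := by
    unfold centeredCubic
    push_cast
    field_simp
    ring
  have h : fociSum (4 * w ^ 3 - 3 * w) ≤
      4 * c * fociSum (centeredCubic (c : ℂ) w) + (1 - 4 * c) * fociSum w := by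
    have n1 : ‖((4 * c : ℝ) : ℂ)‖ = 4 * c := by
      rw [Complex.norm_real, Real.norm_of_nonneg (by linarith)]
    have n2 : ‖((1 - 4 * c : ℝ) : ℂ)‖ = 1 - 4 * c := by
      rw [Complex.norm_real, Real.norm_of_nonneg (by linarith)]
    have e1 : 4 * w ^ 3 - 3 * w - 1 = ((4 * c : ℝ) : ℂ) * (centeredCubic (c : ℂ) w - 1) +
        ((1 - 4 * c : ℝ) : ℂ) * (w - 1) := by rw [e]; push_cast; ring
    have e2 : 4 * w ^ 3 - 3 * w + 1 = ((4 * c : ℝ) : ℂ) * (centeredCubic (c : ℂ) w + 1) +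
        ((1 - 4 * c : ℝ) : ℂ) * (w + 1) := by rw [e]; push_cast; ring
    have h1 := norm_add_le (((4 * c : ℝ) : ℂ) * (centeredCubic (c : ℂ) w - 1))
      (((1 - 4 * c : ℝ) : ℂ) * (w - 1))
    have h2 := norm_add_le (((4 * c : ℝ) : ℂ) * (centeredCubic (c : ℂ) w + 1))
      (((1 - 4 * c : ℝ) : ℂ) * (w + 1))
    rw [← e1, norm_mul, norm_mul, n1, n2] at h1
    rw [← e2, norm_mul, norm_mul, n1, n2] at h2
    unfold fociSum
    linarith
  rw [fociSum_chebyshev] at h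
  have hE := two_le_fociSum w
  generalize fociSum w = E at *
  generalize fociSum (centeredCubic (c : ℂ) w) = E' at *
  -- This is what remains after subtracting `36c(E - 2)`; the second factor is nonnegative because
  -- `E ≥ 2` and `c ≤ 1/4`.
  have hq : 0 ≤ (E - 2) * (E ^ 2 + 2 * E - 32 * c) := mul_nonneg (by linarith) (by nlinarith)
  have : 0 ≤ (4 * c) * (E' - 2 - 9 * (E - 2)) := by nlinarith
  have := nonneg_of_mul_nonneg_right this (by linarith)
  linarith

theorem pow_mul_fociSum_sub_two_le (hc : 0 < c) (hc4 : c ≤ 1 / 4) (w : ℂ) (n : ℕ) :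
    9 ^ n * (fociSum w - 2) ≤ fociSum ((centeredCubic (c : ℂ))^[n] w) - 2 := by
  induction n with
  | zero => simp
  | succ n ih =>
    rw [Function.iterate_succ_apply']
    have := nine_mul_fociSum_sub_two_le hc hc4 ((centeredCubic (c : ℂ))^[n] w)
    rw [pow_succ]
    linarith

/-- An orbit whose foci sum never exceeds 2 never leaves the segment, hence is real and trapped. -/
theorem exists_trapped_or_exists_two_lt_fociSum (c : ℝ) (w : ℂ) :
    (∃ x ∈ trappedSet c, w = (x : ℂ)) ∨
      ∃ n, 2 < fociSum ((centeredCubic (c : ℂ))^[n] w) := by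
  by_cases h : ∃ n, 2 < fociSum ((centeredCubic (c : ℂ))^[n] w)
  · exact Or.inr h
  · push Not at h
    refine Or.inl ⟨w.re, fun n => ?_, (eq_ofReal_of_fociSum_le (h 0)).1⟩
    have hn := (eq_ofReal_of_fociSum_le (h n)).2
    have hw : w = (w.re : ℂ) := (eq_ofReal_of_fociSum_le (h 0)).1
    rwa [hw, ← ofReal_iterate_centeredCubic, Complex.ofReal_re] at hn

theorem tendsto_norm_iterate_centeredCubic (hc : 0 < c) (hc4 : c ≤ 1 / 4) {w : ℂ} {m : ℕ}
    (h : 2 < fociSum ((centeredCubic (c : ℂ))^[m] w)) :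
    Tendsto (fun n => ‖(centeredCubic (c : ℂ))^[n] w‖) atTop atTop := by
  rw [← tendsto_add_atTop_iff_nat m]
  have hlim : Tendsto (fun n : ℕ => (9 : ℝ) ^ n *
      (fociSum ((centeredCubic (c : ℂ))^[m] w) - 2) / 2) atTop atTop :=
    ((tendsto_pow_atTop_atTop_of_one_lt (by norm_num)).atTop_mul_const
      (by linarith)).atTop_div_const (by norm_num)
  refine tendsto_atTop_mono (fun n => ?_) hlim
  rw [Function.iterate_add_apply]
  have h1 := pow_mul_fociSum_sub_two_le hc hc4 ((centeredCubic (c : ℂ))^[m] w) n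
  have h2 := fociSum_le ((centeredCubic (c : ℂ))^[n] ((centeredCubic (c : ℂ))^[m] w))
  linarith

/-- A bounded orbit is trapped in the real interval `[-1, 1]`. -/
theorem exists_trapped_of_bounded (hc : 0 < c) (hc4 : c ≤ 1 / 4) {w : ℂ} {M : ℝ}
    (h : ∀ n, ‖(centeredCubic (c : ℂ))^[n] w‖ ≤ M) : ∃ x ∈ trappedSet c, w = (x : ℂ) := by
  refine (exists_trapped_or_exists_two_lt_fociSum c w).resolve_right fun ⟨m, hm⟩ => ?_
  obtain ⟨n, hn⟩ := ((tendsto_norm_iterate_centeredCubic hc hc4 hm).eventually_gt_atTop M).exists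
  exact (h n).not_gt hn

end ComplexDynamics

/-! ### The Julia set of the cubic -/

namespace PQModel

open Topology Set

theorem iterate_onePointMap_infty {X : Type*} (f : X → X) (n : ℕ) :
    (OnePoint.map f)^[n] OnePoint.infty = OnePoint.infty :=
  Function.iterate_fixed (by simp) n

theorem iterate_onePointMap_coe {X : Type*} (f : X → X) (n : ℕ) (x : X) :
    (OnePoint.map f)^[n] (x : OnePoint X) = (f^[n] x : X) := by
  induction n with
  | zero => rfl
  | succ n ih => rw [Function.iterate_succ_apply', ih, OnePoint.map_some,
      Function.iterate_succ_apply']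

theorem cubic_eq_centeredCubic {p : ℝ} (hp0 : 0 < p) (hp1 : p < 1) (z : ℂ) :
    cubic p z = centeredCubic ((p * (1 - p) : ℝ) : ℂ) (z - 1) + 1 := by
  have h1 : (p : ℂ) ≠ 0 := Complex.ofReal_ne_zero.2 hp0.ne'
  have h2 : (1 : ℂ) - p ≠ 0 := by
    rw [← Complex.ofReal_one, ← Complex.ofReal_sub]
    exact Complex.ofReal_ne_zero.2 (by linarith)
  unfold cubic centeredCubic
  push_cast
  field_simp
  ring

theorem iterate_cubic {p : ℝ} (hp0 : 0 < p) (hp1 : p < 1) (z : ℂ) (n : ℕ) :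
    (cubic p)^[n] z = (centeredCubic ((p * (1 - p) : ℝ) : ℂ))^[n] (z - 1) + 1 := by
  induction n with
  | zero => simp
  | succ n ih =>
    rw [Function.iterate_succ_apply', Function.iterate_succ_apply', ih,
      cubic_eq_centeredCubic hp0 hp1, add_sub_cancel_right]

theorem mul_one_sub_le (p : ℝ) : p * (1 - p) ≤ 1 / 4 := by nlinarith [sq_nonneg (p - 1 / 2)]

theorem continuous_cubic (p : ℝ) : Continuous (cubic p) := by
  unfold cubic
  fun_prop

/-- Every sequence of natural numbers has a subsequence which is constant or diverges. -/
theorem exists_subseq_const_or_tendsto (k : ℕ → ℕ) :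
    ∃ φ : ℕ → ℕ, StrictMono φ ∧
      ((∃ m, ∀ n, k (φ n) = m) ∨ Tendsto (fun n => k (φ n)) atTop atTop) := by
  obtain ⟨g, hg | hg⟩ := exists_increasing_or_nonincreasing_subseq (· < ·) k
  · exact ⟨g, g.strictMono, Or.inr (StrictMono.tendsto_atTop fun m n h => hg m n h)⟩
  · obtain ⟨n₀, hn₀⟩ : ∃ n₀, ∀ n, k (g n₀) ≤ k (g n) := by
      obtain ⟨n₀, -, h⟩ := WellFounded.has_min (measure fun n => k (g n)).wf univ univ_nonempty
      exact ⟨n₀, fun n => not_lt.1 (h n (mem_univ n))⟩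
    refine ⟨fun n => g (n₀ + n), fun m n h => g.strictMono (by omega),
      Or.inl ⟨k (g n₀), fun n => ?_⟩⟩
    rcases Nat.eq_zero_or_pos n with rfl | hn
    · rfl
    · exact le_antisymm (not_lt.1 (hg n₀ (n₀ + n) (by omega))) (hn₀ _)

theorem chordalDist_self (z : OnePoint ℂ) : chordalDist z z = 0 := by
  induction z using OnePoint.rec with
  | infty => rfl
  | coe z => simp [chordalDist]

theorem chordalDist_coe_infty_lt {v : ℂ} {ε : ℝ} (hε : 0 < ε) (h : 2 / ε < ‖v‖) :
    chordalDist v OnePoint.infty < ε := by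
  have h0 : 0 < ‖v‖ := lt_trans (by positivity) h
  have hs : ‖v‖ ≤ √(1 + ‖v‖ ^ 2) := Real.le_sqrt_of_sq_le (by linarith)
  change 2 / √(1 + ‖v‖ ^ 2) < ε
  rw [div_lt_iff₀ (by linarith), mul_comm]
  rw [div_lt_iff₀ hε] at h
  nlinarith

variable {p : ℝ}

/-- The foci sum grows at a rate that is uniform on `U` from time `N` on, so iterates with diverging
exponents converge uniformly to infinity. Sequences of exponents without a diverging subsequence
have a constant one. -/
theorem normalIterates_of_fociSum (hp0 : 0 < p) (hp1 : p < 1) {U : Set (OnePoint ℂ)} {N : ℕ}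
    {δ : ℝ} (hδ : 0 < δ) (hU : ∀ z : ℂ, (z : OnePoint ℂ) ∈ U →
      2 + δ ≤ fociSum ((centeredCubic ((p * (1 - p) : ℝ) : ℂ))^[N] (z - 1))) :
    NormalIterates (OnePoint.map (cubic p)) U := by
  have hc : 0 < p * (1 - p) := mul_pos hp0 (by linarith)
  intro k
  obtain ⟨φ, hφ, ⟨m, hm⟩ | hk⟩ := exists_subseq_const_or_tendsto k
  · refine ⟨φ, hφ, (OnePoint.map (cubic p))^[m], fun K _ _ ε hε => ?_⟩
    refine Eventually.of_forall fun n z _ => ?_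
    rwa [hm, chordalDist_self]
  · refine ⟨φ, hφ, fun _ => OnePoint.infty, fun K hK _ ε hε => ?_⟩
    have hlim : Tendsto (fun n : ℕ => (9 : ℝ) ^ (k (φ n) - N) * δ) atTop atTop :=
      ((tendsto_pow_atTop_atTop_of_one_lt (by norm_num)).comp
        ((tendsto_sub_atTop_nat N).comp hk)).atTop_mul_const hδ
    filter_upwards [hk.eventually_ge_atTop N,
      hlim.eventually_gt_atTop (2 * (2 / ε) + 2)] with n hn hlarge z hz
    induction z using OnePoint.rec with
    | infty => rwa [iterate_onePointMap_infty, chordalDist_self]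
    | coe z =>
      rw [iterate_onePointMap_coe, iterate_cubic hp0 hp1]
      apply chordalDist_coe_infty_lt hε
      obtain ⟨j, hj⟩ := Nat.exists_eq_add_of_le' hn
      rw [hj, Function.iterate_add_apply]
      rw [hj, Nat.add_sub_cancel] at hlarge
      have h1 := hU z (hK hz)
      have h2 := pow_mul_fociSum_sub_two_le hc (mul_one_sub_le p)
        ((centeredCubic ((p * (1 - p) : ℝ) : ℂ))^[N] (z - 1)) j
      generalize (centeredCubic ((p * (1 - p) : ℝ) : ℂ))^[N] (z - 1) = w at *
      have h3 := fociSum_le ((centeredCubic ((p * (1 - p) : ℝ) : ℂ))^[j] w)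
      have h4 := norm_sub_le ((centeredCubic ((p * (1 - p) : ℝ) : ℂ))^[j] w + 1) 1
      rw [add_sub_cancel_right, norm_one] at h4
      have h5 : (9 : ℝ) ^ j * δ ≤ 9 ^ j * (fociSum w - 2) :=
        mul_le_mul_of_nonneg_left (by linarith) (by positivity)
      linarith

theorem infty_mem_fatouSet (hp0 : 0 < p) (hp1 : p < 1) :
    OnePoint.infty ∈ fatouSet (OnePoint.map (cubic p)) := by
  have hcl : IsClosed {z : ℂ | fociSum (z - 1) ≤ 3} :=
    isClosed_le (continuous_fociSum.comp (by fun_prop)) continuous_const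
  have hcpt : IsCompact {z : ℂ | fociSum (z - 1) ≤ 3} := by
    refine Metric.isCompact_of_isClosed_isBounded hcl
      ((Metric.isBounded_closedBall (x := (1 : ℂ)) (r := 2)).subset fun z hz => ?_)
    have h1 := two_mul_norm_le_fociSum (z - 1)
    have h2 : fociSum (z - 1) ≤ 3 := hz
    rw [Metric.mem_closedBall, dist_eq_norm]
    linarith
  refine ⟨((↑) '' {z : ℂ | fociSum (z - 1) ≤ 3})ᶜ,
    OnePoint.isOpen_compl_image_coe.2 ⟨hcl, hcpt⟩, by simp, ?_⟩
  refine normalIterates_of_fociSum hp0 hp1 (N := 0) (δ := 1) one_pos fun z hz => ?_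
  by_contra! hlt
  refine hz ⟨z, ?_, rfl⟩
  change fociSum (z - 1) ≤ 3
  rw [Function.iterate_zero_apply] at hlt
  linarith

theorem coe_mem_fatouSet (hp0 : 0 < p) (hp1 : p < 1) {z : ℂ} {N : ℕ}
    (h : 2 < fociSum ((centeredCubic ((p * (1 - p) : ℝ) : ℂ))^[N] (z - 1))) :
    (z : OnePoint ℂ) ∈ fatouSet (OnePoint.map (cubic p)) := by
  obtain ⟨r, hr, hr'⟩ := exists_between h
  have hopen : IsOpen {z : ℂ | r < fociSum ((centeredCubic ((p * (1 - p) : ℝ) : ℂ))^[N] (z - 1))} :=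
    isOpen_lt continuous_const (continuous_fociSum.comp
      (((continuous_centeredCubic _).iterate N).comp (by fun_prop)))
  refine ⟨_, OnePoint.isOpenEmbedding_coe.isOpenMap _ hopen, ⟨z, hr', rfl⟩, ?_⟩
  refine normalIterates_of_fociSum hp0 hp1 (N := N) (δ := r - 2) (by linarith) ?_
  rintro _ ⟨w, hw, hwz⟩
  rw [← OnePoint.coe_injective hwz]
  have hw' : r < fociSum ((centeredCubic ((p * (1 - p) : ℝ) : ℂ))^[N] (w - 1)) := hw
  linarith

/-- If iterates which tend to infinity at a point converge chordally, the limit is infinity. -/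
theorem eq_infty_of_chordalDist_tendsto {v : ℕ → ℂ} {g : OnePoint ℂ}
    (hv : Tendsto (fun n => ‖v n‖) atTop atTop)
    (h : ∀ ε : ℝ, 0 < ε → ∀ᶠ n in atTop, chordalDist (v n) g < ε) : g = OnePoint.infty := by
  induction g using OnePoint.rec with
  | infty => rfl
  | coe g =>
    exfalso
    have hg : 0 < √(1 + ‖g‖ ^ 2) := by positivity
    obtain ⟨n, hn, hn'⟩ := ((h (1 / √(1 + ‖g‖ ^ 2)) (by positivity)).and
      (hv.eventually_gt_atTop (1 + 2 * ‖g‖))).exists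
    change 2 * ‖v n - g‖ / (√(1 + ‖v n‖ ^ 2) * √(1 + ‖g‖ ^ 2)) < _ at hn
    have hvn : 0 < √(1 + ‖v n‖ ^ 2) := by positivity
    rw [div_lt_div_iff₀ (by positivity) hg, one_mul, mul_lt_mul_iff_left₀ hg] at hn
    have h1 : √(1 + ‖v n‖ ^ 2) ≤ 1 + ‖v n‖ := by
      rw [Real.sqrt_le_left (by positivity)]
      nlinarith [norm_nonneg (v n)]
    have h2 := norm_sub_norm_le (v n) g
    linarith

/-- Non-real points escape, so they force any subsequential limit to be infinity arbitrarily close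
to a trapped point, where the iterates themselves stay bounded. -/
theorem coe_notMem_fatouSet (hp0 : 0 < p) (hp1 : p < 1) {x : ℝ}
    (hx : x ∈ trappedSet (p * (1 - p))) :
    (((x + 1 : ℝ) : ℂ) : OnePoint ℂ) ∉ fatouSet (OnePoint.map (cubic p)) := by
  rintro ⟨U, hU, hxU, hnormal⟩
  have hc : 0 < p * (1 - p) := mul_pos hp0 (by linarith)
  obtain ⟨φ, hφ, G, hG⟩ := hnormal id
  have hnhds : ((↑) : ℂ → OnePoint ℂ) ⁻¹' U ∈ 𝓝 ((x + 1 : ℝ) : ℂ) :=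
    (hU.preimage OnePoint.continuous_coe).mem_nhds hxU
  obtain ⟨r, hr, hball⟩ := Metric.nhds_basis_closedBall.mem_iff.1 hnhds
  have hconv := hG ((↑) '' Metric.closedBall ((x + 1 : ℝ) : ℂ) r) (image_subset_iff.2 hball)
    ((isCompact_closedBall _ _).image OnePoint.continuous_coe)
  have hGinf : ∀ w ∈ Metric.closedBall ((x + 1 : ℝ) : ℂ) r, w.im ≠ 0 → G w = OnePoint.infty := by
    intro w hw him
    have hesc := (exists_trapped_or_exists_two_lt_fociSum (p * (1 - p)) (w - 1)).resolve_left
      fun ⟨y, _, hy⟩ => him (by have := congrArg Complex.im hy; simpa using this)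
    obtain ⟨m, hm⟩ := hesc
    have hlim : Tendsto (fun n => ‖(cubic p)^[n] w‖) atTop atTop := by
      refine tendsto_atTop_mono (fun n => ?_) (tendsto_atTop_add_const_right atTop (-1)
        (tendsto_norm_iterate_centeredCubic hc (mul_one_sub_le p) hm))
      rw [iterate_cubic hp0 hp1]
      have h4 := norm_sub_le
        ((centeredCubic ((p * (1 - p) : ℝ) : ℂ))^[n] (w - 1) + 1) 1
      rw [add_sub_cancel_right, norm_one] at h4
      linarith
    refine eq_infty_of_chordalDist_tendsto (hlim.comp hφ.tendsto_atTop) fun ε hε => ?_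
    filter_upwards [hconv ε hε] with n hn
    have := hn w ⟨w, hw, rfl⟩
    rwa [iterate_onePointMap_coe] at this
  -- One index suffices: chordal distance below `1/2` from infinity needs modulus above `√15`, while
  -- by continuity the iterate has modulus below 3 at a non-real point just above the trapped one.
  obtain ⟨n, hn⟩ := (hconv (1 / 2) (by norm_num)).exists
  have hcont : Tendsto (fun s : ℝ => ‖(cubic p)^[φ n] (((x + 1 : ℝ) : ℂ) + s * Complex.I)‖)
      (𝓝[>] 0) (𝓝 ‖(cubic p)^[φ n] ((x + 1 : ℝ) : ℂ)‖) := by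
    have : Continuous fun s : ℝ => ‖(cubic p)^[φ n] (((x + 1 : ℝ) : ℂ) + s * Complex.I)‖ :=
      (((continuous_cubic p).iterate _).comp (by fun_prop)).norm
    have h0 := (this.tendsto 0).mono_left (nhdsWithin_le_nhds (s := Ioi 0))
    simpa using h0
  have hbound : ‖(cubic p)^[φ n] ((x + 1 : ℝ) : ℂ)‖ < 3 := by
    rw [iterate_cubic hp0 hp1, Complex.ofReal_add, Complex.ofReal_one, add_sub_cancel_right,
      ← ofReal_iterate_centeredCubic]
    refine (norm_add_le _ _).trans_lt ?_
    rw [norm_one, Complex.norm_real, Real.norm_eq_abs]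
    have := abs_le.2 (hx (φ n))
    linarith
  obtain ⟨s, ⟨hs1, hs2⟩⟩ := ((hcont.eventually_lt_const hbound).and (Ioc_mem_nhdsGT hr)).exists
  set w : ℂ := ((x + 1 : ℝ) : ℂ) + s * Complex.I with hw
  have hwball : w ∈ Metric.closedBall ((x + 1 : ℝ) : ℂ) r := by
    rw [Metric.mem_closedBall, dist_eq_norm, hw, add_sub_cancel_left, norm_mul, Complex.norm_I,
      mul_one, Complex.norm_real, Real.norm_of_nonneg hs2.1.le]
    exact hs2.2
  have hdist := hn w ⟨w, hwball, rfl⟩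
  rw [hGinf w hwball (by simp [hw, hs2.1.ne']), iterate_onePointMap_coe] at hdist
  change 2 / √(1 + ‖(cubic p)^[φ n] w‖ ^ 2) < 1 / 2 at hdist
  have hsq : √(1 + ‖(cubic p)^[φ n] w‖ ^ 2) ≤ 4 := by
    rw [Real.sqrt_le_left (by norm_num)]
    nlinarith [norm_nonneg ((cubic p)^[φ n] w)]
  rw [div_lt_iff₀ (by positivity)] at hdist
  linarith

theorem cubicJulia_eq (hp0 : 0 < p) (hp1 : p < 1) :
    cubicJulia p = (fun x : ℝ => (((x + 1 : ℝ) : ℂ) : OnePoint ℂ)) '' trappedSet (p * (1 - p)) := by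
  ext z
  constructor
  · intro hz
    induction z using OnePoint.rec with
    | infty => exact (hz (infty_mem_fatouSet hp0 hp1)).elim
    | coe z =>
      rcases exists_trapped_or_exists_two_lt_fociSum (p * (1 - p)) (z - 1) with
        ⟨x, hx, hxz⟩ | ⟨n, hn⟩
      · refine ⟨x, hx, ?_⟩
        rw [sub_eq_iff_eq_add] at hxz
        simp [hxz]
      · exact (hz (coe_mem_fatouSet hp0 hp1 hn)).elim
  · rintro ⟨x, hx, rfl⟩
    exact coe_notMem_fatouSet hp0 hp1 hx

theorem exists_lt_add_eq_one (hp0 : 0 < p) (hp1 : p < 1) (hp : p ≠ 1 / 2) :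
    ∃ a b : ℝ, 0 < a ∧ a < b ∧ a + b = 1 ∧ p * (1 - p) = a * b := by
  rcases lt_or_gt_of_ne hp with h | h
  · exact ⟨p, 1 - p, hp0, by linarith, by ring, rfl⟩
  · exact ⟨1 - p, p, by linarith, by linarith, by ring, by ring⟩

theorem nonempty_cubicJulia_homeomorph_cantorSet (hp0 : 0 < p) (hp1 : p < 1) (hp : p ≠ 1 / 2) :
    Nonempty (cubicJulia p ≃ₜ cantorSet) := by
  obtain ⟨a, b, ha, hab, h1, hc⟩ := exists_lt_add_eq_one hp0 hp1 hp
  obtain ⟨e⟩ := nonempty_trappedSet_homeomorph_cantorSet ha hab h1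
  have hemb : IsEmbedding fun x : ℝ => (((x + 1 : ℝ) : ℂ) : OnePoint ℂ) :=
    OnePoint.isOpenEmbedding_coe.isEmbedding.comp
      (Complex.isometry_ofReal.isEmbedding.comp (Homeomorph.addRight (1 : ℝ)).isEmbedding)
  rw [cubicJulia_eq hp0 hp1, hc]
  exact ⟨(hemb.homeomorphImage _).symm.trans e⟩

theorem ofReal_mem_cubicJulia_iff (hp0 : 0 < p) (hp1 : p < 1) (t : ℝ) :
    ((t : ℂ) : OnePoint ℂ) ∈ cubicJulia p ↔ t - 1 ∈ trappedSet (p * (1 - p)) := by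
  rw [cubicJulia_eq hp0 hp1]
  constructor
  · rintro ⟨x, hx, h⟩
    have h2 := Complex.ofReal_injective (OnePoint.coe_injective h)
    rwa [← h2, add_sub_cancel_right]
  · exact fun h => ⟨t - 1, h, by simp⟩

theorem volume_shifted_trappedSet (hp0 : 0 < p) (hp1 : p < 1) (hp : p ≠ 1 / 2) :
    volume {t : ℝ | t - 1 ∈ trappedSet (p * (1 - p))} = 0 := by
  obtain ⟨a, b, ha, hab, h1, hc⟩ := exists_lt_add_eq_one hp0 hp1 hp
  have := measure_preimage_add_right (volume : Measure ℝ) (-1) (trappedSet (a * b))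
  rw [volume_trappedSet ha hab h1] at this
  rw [hc]
  exact this

theorem volume_cubicJulia (hp0 : 0 < p) (hp1 : p < 1) (hp : p ≠ 1 / 2) :
    volume {t : ℝ | ((t : ℂ) : OnePoint ℂ) ∈ cubicJulia p} = 0 := by
  simp_rw [ofReal_mem_cubicJulia_iff hp0 hp1]
  exact volume_shifted_trappedSet hp0 hp1 hp

theorem cubicJulia_subset_range (hp0 : 0 < p) (hp1 : p < 1) :
    cubicJulia p ⊆ range fun t : ℝ => ((t : ℂ) : OnePoint ℂ) := by
  rw [cubicJulia_eq hp0 hp1]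
  rintro _ ⟨x, -, rfl⟩
  exact ⟨x + 1, rfl⟩

end PQModel

/-! ### Spectral decimation -/

namespace PQModel

open Topology

/-- A positive weight on `ℤ₊` which is invariant under `x ↦ 3 x` and whose values at neighbours
are comparable. -/
structure IsSelfSimilarWeight (w : ℕ → ℝ) : Prop where
  pos : ∀ x, 0 < w x
  triple : ∀ x, w (3 * x) = w x
  comparable : ∃ C : ℝ, ∀ x, w (x + 1) ≤ C * w x ∧ w x ≤ C * w (x + 1)

/-- Square summability with respect to a weight. -/
def SqSummable (w : ℕ → ℝ) (f : ℕ → ℂ) : Prop := Summable fun x => w x * ‖f x‖ ^ 2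

/-! ### Stability of weighted square summability under shifts, dilation and interleaving -/

section SqSummable

variable {w : ℕ → ℝ} {f g : ℕ → ℂ}

theorem SqSummable.of_norm_le (hw : IsSelfSimilarWeight w) (hf : SqSummable w f) (M : ℝ)
    (h : ∀ x, ‖g x‖ ≤ M * ‖f x‖) : SqSummable w g := by
  refine Summable.of_nonneg_of_le (fun x => mul_nonneg (hw.pos x).le (sq_nonneg _)) (fun x => ?_)
    (hf.mul_left (M ^ 2))
  calc w x * ‖g x‖ ^ 2 ≤ w x * (M * ‖f x‖) ^ 2 :=
        mul_le_mul_of_nonneg_left (pow_le_pow_left₀ (norm_nonneg _) (h x) 2) (hw.pos x).le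
    _ = M ^ 2 * (w x * ‖f x‖ ^ 2) := by ring

theorem SqSummable.add (hw : IsSelfSimilarWeight w) (hf : SqSummable w f) (hg : SqSummable w g) :
    SqSummable w fun x => f x + g x := by
  refine Summable.of_nonneg_of_le (fun x => mul_nonneg (hw.pos x).le (sq_nonneg _)) (fun x => ?_)
    ((Summable.add hf hg).mul_left 2)
  have h1 : ‖f x + g x‖ ^ 2 ≤ (‖f x‖ + ‖g x‖) ^ 2 :=
    pow_le_pow_left₀ (norm_nonneg _) (norm_add_le _ _) 2
  have h2 : ‖f x + g x‖ ^ 2 ≤ 2 * (‖f x‖ ^ 2 + ‖g x‖ ^ 2) := by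
    nlinarith [sq_nonneg (‖f x‖ - ‖g x‖)]
  calc w x * ‖f x + g x‖ ^ 2 ≤ w x * (2 * (‖f x‖ ^ 2 + ‖g x‖ ^ 2)) :=
        mul_le_mul_of_nonneg_left h2 (hw.pos x).le
    _ = 2 * (w x * ‖f x‖ ^ 2 + w x * ‖g x‖ ^ 2) := by ring

theorem SqSummable.const_mul (hw : IsSelfSimilarWeight w) (hf : SqSummable w f) (c : ℂ) :
    SqSummable w fun x => c * f x :=
  hf.of_norm_le hw ‖c‖ fun _ => (norm_mul _ _).le

theorem SqSummable.mul_left (hw : IsSelfSimilarWeight w) (hf : SqSummable w f) {a : ℕ → ℂ}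
    (ha : ∀ x, ‖a x‖ ≤ 1) : SqSummable w fun x => a x * f x :=
  hf.of_norm_le hw 1 fun x => by
    rw [norm_mul]
    exact mul_le_mul_of_nonneg_right (ha x) (norm_nonneg _)

theorem SqSummable.comp_succ (hw : IsSelfSimilarWeight w) (hf : SqSummable w f) :
    SqSummable w fun x => f (x + 1) := by
  obtain ⟨C, hC⟩ := hw.comparable
  refine Summable.of_nonneg_of_le (fun x => mul_nonneg (hw.pos x).le (sq_nonneg _)) (fun x => ?_)
    (((summable_nat_add_iff 1).2 hf).mul_left C)
  rw [← mul_assoc]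
  exact mul_le_mul_of_nonneg_right (hC x).2 (sq_nonneg _)

theorem SqSummable.comp_pred (hw : IsSelfSimilarWeight w) (hf : SqSummable w f) :
    SqSummable w fun x => f (x - 1) := by
  obtain ⟨C, hC⟩ := hw.comparable
  refine (summable_nat_add_iff 1).1 (Summable.of_nonneg_of_le
    (fun x => mul_nonneg (hw.pos _).le (sq_nonneg _)) (fun x => ?_) (Summable.mul_left C hf))
  rw [← mul_assoc]
  exact mul_le_mul_of_nonneg_right (hC x).1 (sq_nonneg _)

theorem SqSummable.comp_triple (hw : IsSelfSimilarWeight w) (hf : SqSummable w f) :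
    SqSummable w fun x => f (3 * x) := by
  have h := Summable.comp_injective hf (i := fun x => 3 * x)
    (mul_right_injective₀ (three_ne_zero))
  refine h.congr fun x => ?_
  simp [Function.comp_apply, hw.triple]

/-- Interleave three sequences. -/
def interleave (u v t : ℕ → ℂ) (x : ℕ) : ℂ :=
  if x % 3 = 0 then u (x / 3) else if x % 3 = 1 then v (x / 3) else t (x / 3)

theorem interleave_zero (u v t : ℕ → ℂ) (k : ℕ) : interleave u v t (3 * k) = u k := by
  unfold interleave
  rw [if_pos (by omega), show 3 * k / 3 = k by omega]

theorem interleave_one (u v t : ℕ → ℂ) (k : ℕ) : interleave u v t (3 * k + 1) = v k := by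
  unfold interleave
  rw [if_neg (by omega), if_pos (by omega), show (3 * k + 1) / 3 = k by omega]

theorem interleave_two (u v t : ℕ → ℂ) (k : ℕ) : interleave u v t (3 * k + 2) = t k := by
  unfold interleave
  rw [if_neg (by omega), if_neg (by omega), show (3 * k + 2) / 3 = k by omega]

theorem summable_of_residues {h : ℕ → ℝ} (hs : ∀ i < 3, Summable fun k => h (3 * k + i)) :
    Summable h := by
  have hpart : ∀ i < 3, Summable fun x => if x % 3 = i then h x else 0 := by
    intro i hi
    have hinj : Function.Injective fun k => 3 * k + i := fun a b hab => by
      simp only at hab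
      omega
    refine (hinj.summable_iff fun x hx => if_neg fun hxi => hx ⟨x / 3, ?_⟩).1 ?_
    · change 3 * (x / 3) + i = x
      omega
    · refine (hs i hi).congr fun k => ?_
      change h (3 * k + i) = if (3 * k + i) % 3 = i then h (3 * k + i) else 0
      rw [if_pos (by omega)]
  refine (((hpart 0 (by norm_num)).add (hpart 1 (by norm_num))).add
    (hpart 2 (by norm_num))).congr fun x => ?_
  have : x % 3 = 0 ∨ x % 3 = 1 ∨ x % 3 = 2 := by omega
  rcases this with h | h | h <;> simp [h]

theorem SqSummable.interleave (hw : IsSelfSimilarWeight w) {u v t : ℕ → ℂ}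
    (hu : SqSummable w u) (hv : SqSummable w v) (ht : SqSummable w t) :
    SqSummable w (interleave u v t) := by
  obtain ⟨C, hC⟩ := hw.comparable
  have hC0 : 0 ≤ C := by
    have h1 := (hC 0).1
    have h2 := hw.pos 0
    have h3 := hw.pos (0 + 1)
    by_contra! h
    nlinarith
  have h1 : ∀ k, w (3 * k + 1) ≤ C * w k := fun k => by
    have := (hC (3 * k)).1
    rwa [hw.triple] at this
  have h2 : ∀ k, w (3 * k + 2) ≤ C * C * w k := fun k => by
    have := (hC (3 * k + 1)).1
    rw [mul_assoc]
    exact this.trans (mul_le_mul_of_nonneg_left (h1 k) hC0)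
  refine summable_of_residues fun i hi => ?_
  interval_cases i
  · refine Summable.congr hu fun k => ?_
    rw [add_zero, interleave_zero, hw.triple]
  · refine Summable.of_nonneg_of_le (fun k => mul_nonneg (hw.pos _).le (sq_nonneg _))
      (fun k => ?_) (Summable.mul_left C hv)
    rw [interleave_one, ← mul_assoc]
    exact mul_le_mul_of_nonneg_right (h1 k) (sq_nonneg _)
  · refine Summable.of_nonneg_of_le (fun k => mul_nonneg (hw.pos _).le (sq_nonneg _))
      (fun k => ?_) (Summable.mul_left (C * C) ht)
    rw [interleave_two, ← mul_assoc]
    exact mul_le_mul_of_nonneg_right (h2 k) (sq_nonneg _)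

end SqSummable

/-! ### Self-similarity of the transition probabilities and of the symmetrizing weight -/

section Coefficients

theorem lastDigit_triple (x : ℕ) : lastDigit (3 * x) = lastDigit x := by
  rcases Nat.eq_zero_or_pos x with rfl | hx
  · rfl
  · have : Fact (Nat.Prime 3) := ⟨Nat.prime_three⟩
    unfold lastDigit
    rw [padicValNat.mul three_ne_zero hx.ne', padicValNat_self, pow_add, pow_one,
      Nat.mul_div_mul_left _ _ three_pos]

theorem lastDigit_of_not_dvd {x : ℕ} (h : ¬ 3 ∣ x) : lastDigit x = x % 3 := by
  unfold lastDigit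
  rw [padicValNat.eq_zero_of_not_dvd h, pow_zero, Nat.div_one]

variable (p : ℝ) (k : ℕ)

theorem up_triple : up p (3 * k) = up p k := by
  simp [up, lastDigit_triple]

theorem down_triple : down p (3 * k) = down p k := by
  simp [down, lastDigit_triple]

theorem up_triple_add_one : up p (3 * k + 1) = p := by
  rw [up, if_neg (by omega), lastDigit_of_not_dvd (by omega), if_pos (by omega)]

theorem up_triple_add_two : up p (3 * k + 2) = 1 - p := by
  rw [up, if_neg (by omega), lastDigit_of_not_dvd (by omega), if_neg (by omega)]

theorem down_triple_add_one : down p (3 * k + 1) = 1 - p := by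
  rw [down, if_neg (by omega), lastDigit_of_not_dvd (by omega), if_pos (by omega)]

theorem down_triple_add_two : down p (3 * k + 2) = p := by
  rw [down, if_neg (by omega), lastDigit_of_not_dvd (by omega), if_neg (by omega)]

theorem up_add_down : up p k + down p k = 1 := by
  unfold up down
  split_ifs <;> ring

theorem down_zero : down p 0 = 0 := by simp [down]

theorem up_zero : up p 0 = 1 := by simp [up]

variable {p} (hp0 : 0 < p) (hp1 : p < 1)
include hp0 hp1

theorem up_pos : 0 < up p k := by
  unfold up
  split_ifs <;> linarith

theorem down_succ_pos : 0 < down p (k + 1) := by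
  unfold down
  rw [if_neg (by omega)]
  split_ifs <;> linarith

theorem down_nonneg : 0 ≤ down p k := by
  unfold down
  split_ifs <;> linarith

theorem norm_up_le : ‖(up p k : ℂ)‖ ≤ 1 := by
  rw [Complex.norm_real, Real.norm_of_nonneg (up_pos k hp0 hp1).le]
  linarith [up_add_down p k, down_nonneg k hp0 hp1]

theorem norm_down_le : ‖(down p k : ℂ)‖ ≤ 1 := by
  rw [Complex.norm_real, Real.norm_of_nonneg (down_nonneg k hp0 hp1)]
  linarith [up_add_down p k, up_pos k hp0 hp1]

theorem weight_pos : 0 < weight p k := by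
  induction k with
  | zero => exact one_pos
  | succ k ih => exact div_pos (mul_pos ih (up_pos k hp0 hp1)) (down_succ_pos k hp0 hp1)

/-- Over a block of three steps the inner factors `p` and `1 - p` cancel, leaving the ratio of one
coarse step. -/
theorem weight_triple : weight p (3 * k) = weight p k := by
  induction k with
  | zero => rfl
  | succ k ih =>
    have h1 : (1 : ℝ) - p ≠ 0 := by linarith
    have h2 := (down_succ_pos k hp0 hp1).ne'
    have h3 : down p (3 * k + 3) = down p (k + 1) := down_triple p (k + 1)
    change weight p (3 * k) * up p (3 * k) / down p (3 * k + 1) * up p (3 * k + 1) /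
      down p (3 * k + 2) * up p (3 * k + 2) / down p (3 * k + 3) =
      weight p k * up p k / down p (k + 1)
    rw [h3, ih, up_triple, up_triple_add_one, up_triple_add_two, down_triple_add_one,
      down_triple_add_two]
    have := hp0.ne'
    field_simp

theorem isSelfSimilarWeight_weight : IsSelfSimilarWeight (weight p) where
  pos x := weight_pos x hp0 hp1
  triple x := weight_triple x hp0 hp1
  comparable := by
    have hm : 0 < min p (1 - p) := lt_min hp0 (by linarith)
    have hup : ∀ x, min p (1 - p) ≤ up p x ∧ up p x ≤ 1 := fun x => by
      have h1 := min_le_left p (1 - p)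
      have h2 := min_le_right p (1 - p)
      unfold up
      constructor <;> split_ifs <;> linarith
    have hdown : ∀ x, min p (1 - p) ≤ down p (x + 1) ∧ down p (x + 1) ≤ 1 := fun x => by
      have h1 := min_le_left p (1 - p)
      have h2 := min_le_right p (1 - p)
      unfold down
      rw [if_neg (by omega)]
      constructor <;> split_ifs <;> linarith
    -- By detailed balance the ratio of neighbouring weights is a ratio of two transition
    -- probabilities in `[min p (1 - p), 1]`.
    refine ⟨(min p (1 - p))⁻¹, fun x => ?_⟩
    have hrev := weight_reversible hp0 hp1 x
    have hwx := weight_pos x hp0 hp1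
    have hwx1 := weight_pos (x + 1) hp0 hp1
    rw [← div_eq_inv_mul, ← div_eq_inv_mul, le_div_iff₀ hm, le_div_iff₀ hm]
    exact ⟨by nlinarith [hup x, hdown x], by nlinarith [hup x, hdown x]⟩

end Coefficients

theorem isSelfSimilarWeight_one : IsSelfSimilarWeight fun _ => 1 where
  pos _ := one_pos
  triple _ := rfl
  comparable := ⟨1, fun _ => by norm_num⟩

/-- Needed for the adjoint on `ℓ²`: if `π f` is square summable, then `f` is so with respect to
`π²`. -/
theorem IsSelfSimilarWeight.sq {w : ℕ → ℝ} (hw : IsSelfSimilarWeight w) :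
    IsSelfSimilarWeight fun x => w x ^ 2 where
  pos x := pow_pos (hw.pos x) 2
  triple x := by rw [hw.triple]
  comparable := by
    obtain ⟨C, hC⟩ := hw.comparable
    refine ⟨C ^ 2, fun x => ?_⟩
    rw [← mul_pow, ← mul_pow]
    exact ⟨pow_le_pow_left₀ (hw.pos _).le (hC x).1 2, pow_le_pow_left₀ (hw.pos _).le (hC x).2 2⟩

/-! ### Renormalization of eigenfunctions and of the resolvent equation -/

section Decimation

variable {p : ℝ} {z : ℂ}

theorem laplacian_zero (f : ℕ → ℂ) : laplacian p f 0 = f 0 - f 1 := by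
  simp [laplacian, up_zero, down_zero]

theorem laplacian_triple_add_one (f : ℕ → ℂ) (k : ℕ) :
    laplacian p f (3 * k + 1) = f (3 * k + 1) - (1 - p) * f (3 * k) - p * f (3 * k + 2) := by
  rw [laplacian, up_triple_add_one, down_triple_add_one]
  push_cast
  rfl

theorem laplacian_triple_add_two (f : ℕ → ℂ) (k : ℕ) :
    laplacian p f (3 * k + 2) =
      f (3 * k + 2) - p * f (3 * k + 1) - (1 - p) * f (3 * (k + 1)) := by
  rw [laplacian, up_triple_add_two, down_triple_add_two]
  push_cast
  rfl

theorem laplacian_triple (f : ℕ → ℂ) (k : ℕ) :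
    laplacian p f (3 * k) =
      f (3 * k) - down p k * f (3 * (k - 1) + 2) - up p k * f (3 * k + 1) := by
  rw [laplacian, up_triple, down_triple]
  cases k with
  | zero => simp [down_zero]
  | succ k => rfl

theorem mul_cubic (hp0 : 0 < p) (hp1 : p < 1) (z : ℂ) :
    (p : ℂ) * (1 - p) * cubic p z = z * (z ^ 2 - 3 * z + 2 + p * (1 - p)) := by
  have h1 : (p : ℂ) ≠ 0 := Complex.ofReal_ne_zero.2 hp0.ne'
  have h2 : (1 : ℂ) - p ≠ 0 := by
    rw [← Complex.ofReal_one, ← Complex.ofReal_sub]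
    exact Complex.ofReal_ne_zero.2 (by linarith)
  unfold cubic
  field_simp

/-- The Schur complement of `Δ_p - z` with respect to the multiples of 3 is a multiple of
`Δ_p - R(z)`. -/
theorem schur_complement (hp0 : 0 < p) (hp1 : p < 1) {f g : ℕ → ℂ} {k : ℕ}
    (h1 : ∀ j, laplacian p f (3 * j + 1) - z * f (3 * j + 1) = g (3 * j + 1))
    (h2 : ∀ j, laplacian p f (3 * j + 2) - z * f (3 * j + 2) = g (3 * j + 2)) :
    (p : ℂ) * (1 - p) * (laplacian p (fun x => f (3 * x)) k - cubic p z * f (3 * k)) =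
      ((1 - z) ^ 2 - p ^ 2) * (laplacian p f (3 * k) - z * f (3 * k)) +
        down p k * (p * g (3 * (k - 1) + 1) + (1 - z) * g (3 * (k - 1) + 2)) +
        up p k * ((1 - z) * g (3 * k + 1) + p * g (3 * k + 2)) := by
  have hud : (up p k : ℂ) = 1 - down p k := by
    rw [eq_sub_iff_add_eq]
    exact_mod_cast up_add_down p k
  have a1 := h1 k
  have a2 := h2 k
  rw [laplacian_triple_add_one] at a1
  rw [laplacian_triple_add_two] at a2
  have hR := mul_cubic hp0 hp1 z
  rw [laplacian_triple, ← a1, ← a2, hud]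
  unfold laplacian
  rw [hud]
  -- At the origin `down` vanishes, so the block on the left contributes nothing; elsewhere its two
  -- equations are needed as well.
  cases k with
  | zero =>
    simp only [down_zero, Complex.ofReal_zero]
    linear_combination (-f (3 * 0)) * hR
  | succ k =>
    have b1 := h1 k
    have b2 := h2 k
    rw [laplacian_triple_add_one] at b1
    rw [laplacian_triple_add_two] at b2
    simp only [Nat.add_sub_cancel]
    rw [← b1, ← b2]
    linear_combination (-f (3 * (k + 1))) * hR

theorem laplacian_triple_eq_of_eigen (hp0 : 0 < p) (hp1 : p < 1) {f : ℕ → ℂ}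
    (h : ∀ x, laplacian p f x = z * f x) (k : ℕ) :
    laplacian p (fun x => f (3 * x)) k = cubic p z * f (3 * k) := by
  have hs := schur_complement (z := z) (f := f) (g := fun _ => 0) (k := k) hp0 hp1
    (fun j => by rw [h, sub_self]) fun j => by rw [h, sub_self]
  rw [h, sub_self] at hs
  have h1 : (p : ℂ) ≠ 0 := Complex.ofReal_ne_zero.2 hp0.ne'
  have h2 : (1 : ℂ) - p ≠ 0 := by
    rw [← Complex.ofReal_one, ← Complex.ofReal_sub]
    exact Complex.ofReal_ne_zero.2 (by linarith)
  simp only [mul_zero, add_zero, mul_eq_zero, h1, h2, or_self, false_or] at hs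
  exact sub_eq_zero.1 hs

theorem laplacian_pow_three_eq_of_eigen (hp0 : 0 < p) (hp1 : p < 1) {f : ℕ → ℂ}
    (h : ∀ x, laplacian p f x = z * f x) (n : ℕ) (k : ℕ) :
    laplacian p (fun x => f (3 ^ n * x)) k = (cubic p)^[n] z * f (3 ^ n * k) := by
  induction n generalizing k with
  | zero => simpa using h k
  | succ n ih =>
    have := laplacian_triple_eq_of_eigen hp0 hp1 ih k
    simp only [← mul_assoc, ← pow_succ] at this
    rw [this, Function.iterate_succ_apply']

theorem eq_zero_of_eigen_of_apply_zero (hp0 : 0 < p) (hp1 : p < 1) {f : ℕ → ℂ}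
    (h : ∀ x, laplacian p f x = z * f x) (h0 : f 0 = 0) : f = 0 := by
  have key : ∀ n, f n = 0 ∧ f (n + 1) = 0 := by
    intro n
    induction n with
    | zero =>
      have := h 0
      rw [laplacian_zero, h0] at this
      exact ⟨h0, by simpa using this⟩
    | succ n ih =>
      refine ⟨ih.2, ?_⟩
      have := h (n + 1)
      rw [laplacian, ih.2, Nat.add_sub_cancel, ih.1] at this
      have hup : (up p (n + 1) : ℂ) ≠ 0 := Complex.ofReal_ne_zero.2 (up_pos _ hp0 hp1).ne'
      simpa [hup] using this
  exact funext fun n => (key n).1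

/-- The Laplacian has no square summable eigenfunctions. -/
theorem eq_zero_of_eigen (hp0 : 0 < p) (hp1 : p < 1) {w : ℕ → ℝ} (hw : IsSelfSimilarWeight w)
    {f : ℕ → ℂ} (hf : SqSummable w f) (h : ∀ x, laplacian p f x = z * f x) : f = 0 := by
  refine eq_zero_of_eigen_of_apply_zero hp0 hp1 h ?_
  have hwpow : ∀ n x, w (3 ^ n * x) = w x := fun n x => by
    induction n with
    | zero => simp
    | succ n ih => rw [pow_succ', mul_assoc, hw.triple, ih]
  -- The weight is constant along `3ⁿx`, so the general term of the convergent series controls `f`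
  -- itself there.
  have hlim : ∀ x, 0 < x → Tendsto (fun n => f (3 ^ n * x)) atTop (𝓝 0) := by
    intro x hx
    have hinf : Tendsto (fun n => 3 ^ n * x) atTop atTop :=
      tendsto_atTop_mono (fun n => (Nat.lt_pow_self (by norm_num : 1 < 3)).le.trans
        (Nat.le_mul_of_pos_right _ hx)) tendsto_id
    have h1 := (Summable.tendsto_atTop_zero hf).comp hinf
    have h2 : Tendsto (fun n => ‖f (3 ^ n * x)‖ ^ 2) atTop (𝓝 0) := by
      have := h1.const_mul (w x)⁻¹
      rw [mul_zero] at this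
      refine this.congr fun n => ?_
      simp only [Function.comp_apply, hwpow]
      rw [inv_mul_cancel_left₀ (hw.pos x).ne']
    have h3 := h2.sqrt
    rw [Real.sqrt_zero] at h3
    rw [tendsto_zero_iff_norm_tendsto_zero]
    exact h3.congr fun n => Real.sqrt_sq (norm_nonneg _)
  by_contra hne
  -- The renormalized equation at the origin forces `Rⁿ(z) → 1`. Then the one at the site 1 has a
  -- left side tending to zero and the constant right side `(1 - p) f(0)`.
  have e0 : ∀ n, 1 - (cubic p)^[n] z = f (3 ^ n * 1) / f 0 := fun n => by
    have := laplacian_pow_three_eq_of_eigen hp0 hp1 h n 0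
    rw [laplacian_zero, mul_zero] at this
    rw [eq_div_iff hne]
    linear_combination this
  have e1 : ∀ n, (1 - (cubic p)^[n] z) * f (3 ^ n * 1) - p * f (3 ^ n * 2) = (1 - p) * f 0 := by
    intro n
    have := laplacian_pow_three_eq_of_eigen hp0 hp1 h n 1
    have h2 := laplacian_triple_add_one (p := p) (fun x => f (3 ^ n * x)) 0
    simp only [mul_zero, zero_add] at h2
    rw [h2] at this
    linear_combination this
  have hl : Tendsto (fun n => (1 - (cubic p)^[n] z) * f (3 ^ n * 1) - p * f (3 ^ n * 2)) atTop
      (𝓝 (0 / f 0 * 0 - p * 0)) := by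
    refine Tendsto.sub (Tendsto.mul ?_ (hlim 1 one_pos)) ((hlim 2 two_pos).const_mul _)
    simp_rw [e0]
    exact (hlim 1 one_pos).div_const _
  simp_rw [e1] at hl
  have := tendsto_nhds_unique hl tendsto_const_nhds
  simp only [zero_div, mul_zero, sub_self] at this
  have h2 : (1 : ℂ) - p ≠ 0 := by
    rw [← Complex.ofReal_one, ← Complex.ofReal_sub]
    exact Complex.ofReal_ne_zero.2 (by linarith)
  exact (mul_ne_zero h2 hne) this.symm

/-- The equation `(Δ_p - z) f = g` has a square summable solution for each square summable `g`. -/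
def Solvable (p : ℝ) (w : ℕ → ℝ) (z : ℂ) : Prop :=
  ∀ g, SqSummable w g → ∃ f, SqSummable w f ∧ ∀ x, laplacian p f x - z * f x = g x

/-- A right side supported on the multiples of 3 produces no correction terms in the Schur
complement, so restricting the fine solution to them solves the coarse equation. -/
theorem Solvable.cubic (hp0 : 0 < p) (hp1 : p < 1) {w : ℕ → ℝ} (hw : IsSelfSimilarWeight w)
    (hd : (1 - z) ^ 2 - (p : ℂ) ^ 2 ≠ 0) (h : Solvable p w z) : Solvable p w (cubic p z) := by
  have h1 : (p : ℂ) ≠ 0 := Complex.ofReal_ne_zero.2 hp0.ne'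
  have h2 : (1 : ℂ) - p ≠ 0 := by
    rw [← Complex.ofReal_one, ← Complex.ofReal_sub]
    exact Complex.ofReal_ne_zero.2 (by linarith)
  intro g hg
  have hzero : SqSummable w fun _ => 0 := by simp [SqSummable]
  obtain ⟨f, hf, hfg⟩ := h (interleave (fun k => (p : ℂ) * (1 - p) / ((1 - z) ^ 2 - p ^ 2) * g k)
    (fun _ => 0) (fun _ => 0)) ((hg.const_mul hw _).interleave hw hzero hzero)
  refine ⟨fun x => f (3 * x), hf.comp_triple hw, fun k => ?_⟩
  have hs := schur_complement (k := k) hp0 hp1 (fun j => hfg (3 * j + 1))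
    (fun j => hfg (3 * j + 2))
  rw [hfg, interleave_zero] at hs
  simp only [interleave_one, interleave_two, mul_zero, add_zero] at hs
  rw [← mul_assoc, mul_div_cancel₀ _ hd] at hs
  exact mul_left_cancel₀ (mul_ne_zero h1 h2) hs

/-- The Schur complement dictates the coarse equation for the values at multiples of 3; the other
two values of each block then come from a linear system with determinant `d`. -/
theorem Solvable.of_cubic (hp0 : 0 < p) (hp1 : p < 1) {w : ℕ → ℝ} (hw : IsSelfSimilarWeight w)
    (hd : (1 - z) ^ 2 - (p : ℂ) ^ 2 ≠ 0) (h : Solvable p w (PQModel.cubic p z)) :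
    Solvable p w z := by
  have h1 : (p : ℂ) ≠ 0 := Complex.ofReal_ne_zero.2 hp0.ne'
  have h2 : (1 : ℂ) - p ≠ 0 := by
    rw [← Complex.ofReal_one, ← Complex.ofReal_sub]
    exact Complex.ofReal_ne_zero.2 (by linarith)
  intro g hg
  set d : ℂ := (1 - z) ^ 2 - (p : ℂ) ^ 2 with hddef
  have hg0 := hg.comp_triple hw
  have hg1 := (hg.comp_succ hw).comp_triple hw
  have hg2 := ((hg.comp_succ hw).comp_succ hw).comp_triple hw
  have hrhs : SqSummable w fun k => d * g (3 * k) +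
        down p k * (p * g (3 * (k - 1) + 1) + (1 - z) * g (3 * (k - 1) + 2)) +
        up p k * ((1 - z) * g (3 * k + 1) + p * g (3 * k + 2)) := by
    refine ((hg0.const_mul hw _).add hw (SqSummable.mul_left hw ?_
      fun k => norm_down_le k hp0 hp1)).add hw (SqSummable.mul_left hw ?_
      fun k => norm_up_le k hp0 hp1)
    · exact ((hg1.comp_pred hw).const_mul hw _).add hw ((hg2.comp_pred hw).const_mul hw _)
    · exact (hg1.const_mul hw _).add hw (hg2.const_mul hw _)
  obtain ⟨u, hu, hug⟩ := h _ (hrhs.const_mul hw ((p : ℂ) * (1 - p))⁻¹)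
  have hu1 := hu.comp_succ hw
  -- `v` and `t` are the values at `3k + 1` and `3k + 2`, obtained by inverting the matrix with
  -- diagonal `1 - z` and off-diagonal `-p`.
  set v : ℕ → ℂ := fun k => d⁻¹ * ((1 - z) * ((1 - p) * u k + g (3 * k + 1)) +
    p * ((1 - p) * u (k + 1) + g (3 * k + 2))) with hv
  set t : ℕ → ℂ := fun k => d⁻¹ * (p * ((1 - p) * u k + g (3 * k + 1)) +
    (1 - z) * ((1 - p) * u (k + 1) + g (3 * k + 2))) with ht
  have hint0 := interleave_zero u v t
  have hint1 := interleave_one u v t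
  have hint2 := interleave_two u v t
  have hsum : SqSummable w (interleave u v t) := by
    refine hu.interleave hw ?_ ?_ <;> refine SqSummable.const_mul hw ?_ _
    · exact ((((hu.const_mul hw _).add hw hg1).const_mul hw _).add hw
        (((hu1.const_mul hw _).add hw hg2).const_mul hw _))
    · exact ((((hu.const_mul hw _).add hw hg1).const_mul hw _).add hw
        (((hu1.const_mul hw _).add hw hg2).const_mul hw _))
  have hr1 : ∀ j, laplacian p (interleave u v t) (3 * j + 1) -
      z * interleave u v t (3 * j + 1) = g (3 * j + 1) := fun j => by
    rw [laplacian_triple_add_one, hint0, hint1, hint2, hv, ht]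
    field_simp
    rw [hddef]
    ring
  have hr2 : ∀ j, laplacian p (interleave u v t) (3 * j + 2) -
      z * interleave u v t (3 * j + 2) = g (3 * j + 2) := fun j => by
    rw [laplacian_triple_add_two, hint0, hint1, hint2, hv, ht]
    field_simp
    rw [hddef]
    ring
  refine ⟨interleave u v t, hsum, fun x => ?_⟩
  have hx : x = 3 * (x / 3) ∨ x = 3 * (x / 3) + 1 ∨ x = 3 * (x / 3) + 2 := by omega
  generalize x / 3 = k at hx
  rcases hx with rfl | rfl | rfl
  · have hs := schur_complement (k := k) hp0 hp1 hr1 hr2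
    simp only [hint0] at hs
    rw [hug, mul_inv_cancel_left₀ (mul_ne_zero h1 h2)] at hs
    rw [hint0]
    have hs' : d * g (3 * k) = d * (laplacian p (interleave u v t) (3 * k) - z * u k) := by
      linear_combination hs
    exact (mul_left_cancel₀ hd hs').symm
  · exact hr1 k
  · exact hr2 k

theorem solvable_cubic_iff (hp0 : 0 < p) (hp1 : p < 1) {w : ℕ → ℝ} (hw : IsSelfSimilarWeight w)
    (hd : (1 - z) ^ 2 - (p : ℂ) ^ 2 ≠ 0) : Solvable p w (cubic p z) ↔ Solvable p w z :=
  ⟨Solvable.of_cubic hp0 hp1 hw hd, Solvable.cubic hp0 hp1 hw hd⟩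

end Decimation

end PQModel

/-! ### The spectrum of the Laplacian on a weighted sequence space -/

namespace PQModel

open Topology Set

theorem laplacian_add (p : ℝ) (f g : ℕ → ℂ) :
    laplacian p (f + g) = laplacian p f + laplacian p g := by
  ext x
  simp only [laplacian, Pi.add_apply]
  ring

theorem laplacian_smul (p : ℝ) (c : ℂ) (f : ℕ → ℂ) :
    laplacian p (c • f) = c • laplacian p f := by
  ext x
  simp only [laplacian, Pi.smul_apply, smul_eq_mul]
  ring

theorem SqSummable.laplacian {p : ℝ} (hp0 : 0 < p) (hp1 : p < 1) {w : ℕ → ℝ}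
    (hw : IsSelfSimilarWeight w) {f : ℕ → ℂ} (hf : SqSummable w f) :
    SqSummable w (laplacian p f) := by
  have h1 := ((hf.comp_pred hw).mul_left hw fun k => norm_down_le k hp0 hp1).const_mul hw (-1)
  have h2 := ((hf.comp_succ hw).mul_left hw fun k => norm_up_le k hp0 hp1).const_mul hw (-1)
  have h3 := (hf.add hw h1).add hw h2
  convert h3 using 2 with x
  simp only [PQModel.laplacian]
  ring

theorem cubic_of_mem_zero_two {p : ℝ} (hp0 : 0 < p) (hp1 : p < 1) {z : ℂ} (hz : z = 0 ∨ z = 2) :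
    cubic p z = z := by
  rw [cubic_eq_centeredCubic hp0 hp1]
  rcases hz with rfl | rfl <;> norm_num [centeredCubic]

/-- The exceptional values are `1 + p ↦ 0` and `1 - p ↦ 2`. As the images are fixed by `R`,
decimation can fail only once along an orbit. -/
theorem cubic_of_exceptional {p : ℝ} (hp0 : 0 < p) (hp1 : p < 1) {z : ℂ}
    (hd : (1 - z) ^ 2 - (p : ℂ) ^ 2 = 0) : cubic p z = 0 ∨ cubic p z = 2 := by
  have h1 : (p : ℂ) ≠ 0 := Complex.ofReal_ne_zero.2 hp0.ne'
  have h2 : (1 : ℂ) - p ≠ 0 := by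
    rw [← Complex.ofReal_one, ← Complex.ofReal_sub]
    exact Complex.ofReal_ne_zero.2 (by linarith)
  have hd' : (1 + p - z) * (1 - p - z) = 0 := by linear_combination hd
  rcases mul_eq_zero.1 hd' with h | h
  · left
    obtain rfl : z = 1 + p := by linear_combination -h
    unfold cubic
    field_simp
    ring
  · right
    obtain rfl : z = 1 - p := by linear_combination -h
    unfold cubic
    field_simp
    ring

variable {H : Type*} [NormedAddCommGroup H] [NormedSpace ℂ H]

/-- `coord` identifies the Banach space `H` with the square summable sequences for a weight. -/
structure IsCoordinates (w : ℕ → ℝ) (coord : H →ₗ[ℂ] ℕ → ℂ) : Prop where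
  injective : Function.Injective coord
  sqSummable_iff : ∀ f, SqSummable w f ↔ ∃ h, coord h = f
  continuous_apply : ∀ x, Continuous fun h => coord h x

theorem sqSummable_single (w : ℕ → ℝ) (x : ℕ) (c : ℂ) : SqSummable w (Pi.single x c) := by
  refine summable_of_ne_finset_zero (s := {x}) fun y hy => ?_
  rw [Pi.single_eq_of_ne (by simpa using hy)]
  simp

namespace IsCoordinates

variable {w : ℕ → ℝ} {coord : H →ₗ[ℂ] ℕ → ℂ} {p : ℝ}

theorem sqSummable (hH : IsCoordinates w coord) (h : H) : SqSummable w (coord h) :=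
  (hH.sqSummable_iff _).2 ⟨h, rfl⟩

theorem nontrivial (hH : IsCoordinates w coord) : Nontrivial H := by
  obtain ⟨h, hh⟩ := (hH.sqSummable_iff _).1 (sqSummable_single w 0 1)
  refine ⟨h, 0, fun h0 => ?_⟩
  rw [h0, map_zero] at hh
  have := congrFun hh 0
  simp at this

variable [CompleteSpace H]

/-- Boundedness comes from the closed graph theorem, as coordinates are continuous and each value of
the Laplacian involves three of them. -/
theorem exists_laplacian (hH : IsCoordinates w coord) (hw : IsSelfSimilarWeight w) (hp0 : 0 < p)
    (hp1 : p < 1) : ∃ T : H →L[ℂ] H, ∀ h, coord (T h) = laplacian p (coord h) := by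
  choose T hT using fun h =>
    (hH.sqSummable_iff _).1 ((hH.sqSummable h).laplacian hp0 hp1 hw)
  let L : H →ₗ[ℂ] H :=
    { toFun := T
      map_add' := fun f g => hH.injective (by
        rw [map_add, hT, hT, hT, map_add, laplacian_add])
      map_smul' := fun c f => hH.injective (by
        rw [map_smul, hT, hT, map_smul, laplacian_smul, RingHom.id_apply]) }
  have hL : ∀ h, coord (L h) = laplacian p (coord h) := hT
  have hcont : Continuous L := by
    refine L.continuous_of_seq_closed_graph fun u x y hu hLu => hH.injective ?_
    ext k
    have h1 := ((hH.continuous_apply k).tendsto y).comp hLu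
    refine tendsto_nhds_unique h1 ?_
    have h2 : ∀ j, Tendsto (fun n => coord (u n) j) atTop (𝓝 (coord x j)) := fun j =>
      ((hH.continuous_apply j).tendsto x).comp hu
    have h3 : Tendsto (fun n => laplacian p (coord (u n)) k) atTop
        (𝓝 (laplacian p (coord x) k)) :=
      ((h2 k).sub ((h2 (k - 1)).const_mul _)).sub ((h2 (k + 1)).const_mul _)
    rw [hL]
    refine h3.congr fun n => ?_
    rw [← hL]
    rfl
  exact ⟨⟨L, hcont⟩, hL⟩

variable {T : H →L[ℂ] H} (hH : IsCoordinates w coord)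
include hH

omit [CompleteSpace H] in
theorem eq_zero_of_eigenvector (hw : IsSelfSimilarWeight w) (hp0 : 0 < p) (hp1 : p < 1)
    (hT : ∀ h, coord (T h) = laplacian p (coord h)) {z : ℂ} {h : H} (hh : T h = z • h) :
    h = 0 := by
  refine hH.injective ?_
  rw [map_zero]
  refine eq_zero_of_eigen (z := z) hp0 hp1 hw (hH.sqSummable h) fun x => ?_
  rw [← hT, hh, map_smul]
  rfl

omit [CompleteSpace H] in
theorem injective_sub_algebraMap (hw : IsSelfSimilarWeight w) (hp0 : 0 < p) (hp1 : p < 1)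
    (hT : ∀ h, coord (T h) = laplacian p (coord h)) (z : ℂ) :
    Function.Injective (T - algebraMap ℂ (H →L[ℂ] H) z) := by
  refine (injective_iff_map_eq_zero _).2 fun h hh => ?_
  refine hH.eq_zero_of_eigenvector hw hp0 hp1 hT (z := z) ?_
  rw [sub_apply, sub_eq_zero] at hh
  simpa [Algebra.algebraMap_eq_smul_one] using hh

/-- Injectivity is automatic in the absence of eigenvectors, so bijectivity, and hence
invertibility, amounts to solvability. -/
theorem mem_spectrum_iff (hw : IsSelfSimilarWeight w) (hp0 : 0 < p) (hp1 : p < 1)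
    (hT : ∀ h, coord (T h) = laplacian p (coord h)) (z : ℂ) :
    z ∈ spectrum ℂ T ↔ ¬ Solvable p w z := by
  rw [spectrum.mem_iff, ← IsUnit.neg_iff, neg_sub, ContinuousLinearMap.isUnit_iff_bijective,
    not_iff_not]
  have hcoord : ∀ h x, coord ((T - algebraMap ℂ (H →L[ℂ] H) z) h) x =
      laplacian p (coord h) x - z * coord h x := fun h x => by
    rw [← hT]
    simp [Algebra.algebraMap_eq_smul_one]
  constructor
  · intro hbij g hg
    obtain ⟨k, rfl⟩ := (hH.sqSummable_iff g).1 hg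
    obtain ⟨h, rfl⟩ := hbij.2 k
    exact ⟨coord h, hH.sqSummable h, fun x => (hcoord h x).symm⟩
  · intro hsolv
    refine ⟨hH.injective_sub_algebraMap hw hp0 hp1 hT z, fun k => ?_⟩
    obtain ⟨f, hf, hfk⟩ := hsolv _ (hH.sqSummable k)
    obtain ⟨h, rfl⟩ := (hH.sqSummable_iff f).1 hf
    exact ⟨h, hH.injective (funext fun x => by rw [hcoord, hfk])⟩

theorem cubic_mem_spectrum_iff (hw : IsSelfSimilarWeight w) (hp0 : 0 < p) (hp1 : p < 1)
    (hT : ∀ h, coord (T h) = laplacian p (coord h)) {z : ℂ}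
    (hd : (1 - z) ^ 2 - (p : ℂ) ^ 2 ≠ 0) : cubic p z ∈ spectrum ℂ T ↔ z ∈ spectrum ℂ T := by
  rw [hH.mem_spectrum_iff hw hp0 hp1 hT, hH.mem_spectrum_iff hw hp0 hp1 hT,
    solvable_cubic_iff hp0 hp1 hw hd]

/-- The orbit of a spectral point stays in the bounded spectrum or lands on `0` or `2` and stops, so
it is bounded and therefore trapped. -/
theorem spectrum_subset (hw : IsSelfSimilarWeight w) (hp0 : 0 < p) (hp1 : p < 1)
    (hT : ∀ h, coord (T h) = laplacian p (coord h)) :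
    spectrum ℂ T ⊆ (fun x : ℝ => ((x + 1 : ℝ) : ℂ)) '' trappedSet (p * (1 - p)) := by
  intro z hz
  have hiter : ∀ n, (cubic p)^[n] z ∈ spectrum ℂ T ∨
      ((cubic p)^[n] z = 0 ∨ (cubic p)^[n] z = 2) := by
    intro n
    induction n with
    | zero => exact Or.inl hz
    | succ n ih =>
      rw [Function.iterate_succ_apply']
      generalize (cubic p)^[n] z = u at ih
      rcases ih with hu | hu
      · by_cases hd : (1 - u) ^ 2 - (p : ℂ) ^ 2 = 0
        · exact Or.inr (cubic_of_exceptional hp0 hp1 hd)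
        · exact Or.inl ((hH.cubic_mem_spectrum_iff hw hp0 hp1 hT hd).2 hu)
      · rw [cubic_of_mem_zero_two hp0 hp1 hu]
        exact Or.inr hu
  obtain ⟨M, hM⟩ := (spectrum.isBounded (𝕜 := ℂ) T).exists_norm_le
  have hbound : ∀ n, ‖(cubic p)^[n] z‖ ≤ max M 2 := fun n => by
    rcases hiter n with h | h | h
    · exact (hM _ h).trans (le_max_left _ _)
    · rw [h, norm_zero]
      exact le_max_of_le_right (by norm_num)
    · rw [h, Complex.norm_ofNat]
      exact le_max_right _ _
  obtain ⟨x, hx, hxz⟩ := exists_trapped_of_bounded (mul_pos hp0 (by linarith : 0 < 1 - p))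
    (mul_one_sub_le p) (w := z - 1) (M := max M 2 + 1) fun n => by
      have h1 := iterate_cubic hp0 hp1 z n
      rw [← sub_eq_iff_eq_add] at h1
      rw [← h1]
      refine (norm_sub_le _ _).trans ?_
      rw [norm_one]
      linarith [hbound n]
  refine ⟨x, hx, ?_⟩
  rw [sub_eq_iff_eq_add] at hxz
  simp [hxz]

theorem mem_spectrum_of_iterate (hw : IsSelfSimilarWeight w) (hp0 : 0 < p) (hp1 : p < 1)
    (hT : ∀ h, coord (T h) = laplacian p (coord h)) {z₀ : ℂ} (hz₀ : z₀ ∈ spectrum ℂ T)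
    (h0 : z₀ ≠ 0) (h2 : z₀ ≠ 2) (n : ℕ) {u : ℂ} (hu : (cubic p)^[n] u = z₀) :
    u ∈ spectrum ℂ T := by
  induction n generalizing u with
  | zero => rwa [← hu] at hz₀
  | succ n ih =>
    rw [Function.iterate_succ_apply] at hu
    refine (hH.cubic_mem_spectrum_iff hw hp0 hp1 hT fun hd => ?_).1 (ih hu)
    have hmem := cubic_of_exceptional hp0 hp1 hd
    rw [Function.iterate_fixed (cubic_of_mem_zero_two hp0 hp1 hmem)] at hu
    rw [hu] at hmem
    exact hmem.elim h0 h2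

/-- The spectrum is nonempty; if the point found is `0` or `2`, it is replaced by a preimage. The
preimages of `0` are `0, 1 + p, 2 - p` and those of `2` are `2, 1 - p, p`; the last of each list is
not exceptional because `p ≠ 1/2`. -/
theorem exists_mem_spectrum_ne (hw : IsSelfSimilarWeight w) (hp0 : 0 < p) (hp1 : p < 1)
    (hp : p ≠ 1 / 2) (hT : ∀ h, coord (T h) = laplacian p (coord h)) :
    ∃ z ∈ spectrum ℂ T, z ≠ 0 ∧ z ≠ 2 := by
  have h1 : (p : ℂ) ≠ 0 := Complex.ofReal_ne_zero.2 hp0.ne'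
  have h2 : (1 : ℂ) - p ≠ 0 := by
    rw [← Complex.ofReal_one, ← Complex.ofReal_sub]
    exact Complex.ofReal_ne_zero.2 (by linarith)
  have h3 : (1 : ℂ) - 2 * p ≠ 0 := by
    intro h
    have h' : (1 : ℝ) - 2 * p = 0 := by exact_mod_cast h
    exact hp (by linarith)
  have h4 : (p : ℂ) ≠ 2 := by
    intro h
    have h' : p = 2 := by exact_mod_cast h
    linarith
  have := hH.nontrivial
  obtain ⟨z, hz⟩ := spectrum.nonempty T
  by_cases hz0 : z = 0
  · refine ⟨2 - p, (hH.cubic_mem_spectrum_iff hw hp0 hp1 hT fun hd => h3 ?_).1 ?_, ?_, ?_⟩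
    · linear_combination hd
    · have : cubic p (2 - p) = 0 := by
        unfold cubic
        field_simp
        ring
      rwa [this, ← hz0]
    · exact sub_ne_zero.2 h4.symm
    · exact fun h => h1 (by linear_combination -h)
  · by_cases hz2 : z = 2
    · refine ⟨p, (hH.cubic_mem_spectrum_iff hw hp0 hp1 hT fun hd => h3 ?_).1 ?_, h1, h4⟩
      · linear_combination hd
      · have : cubic p p = 2 := by
          unfold cubic
          field_simp
          ring
        rwa [this, ← hz2]
    · exact ⟨z, hz, hz0, hz2⟩

/-- One spectral point off `{0, 2}` pulls all its iterated preimages into the spectrum; these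
accumulate at every trapped point, and the spectrum is closed. -/
theorem spectrum_eq (hw : IsSelfSimilarWeight w) (hp0 : 0 < p) (hp1 : p < 1)
    (hp : p ≠ 1 / 2) (hT : ∀ h, coord (T h) = laplacian p (coord h)) :
    spectrum ℂ T = (fun x : ℝ => ((x + 1 : ℝ) : ℂ)) '' trappedSet (p * (1 - p)) := by
  refine (hH.spectrum_subset hw hp0 hp1 hT).antisymm ?_
  obtain ⟨z, hz, hz0, hz2⟩ := hH.exists_mem_spectrum_ne hw hp0 hp1 hp hT
  obtain ⟨x, hx, hxz⟩ := hH.spectrum_subset hw hp0 hp1 hT hz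
  rintro _ ⟨y, hy, rfl⟩
  obtain ⟨a, b, ha, hab, h1, hc⟩ := exists_lt_add_eq_one hp0 hp1 hp
  rw [hc] at hx hy
  obtain ⟨u, hu, hlim⟩ := exists_tendsto_iterate_centeredCubic_eq ha hab h1 hx hy
  have hlim' : Tendsto (fun n => ((u n + 1 : ℝ) : ℂ)) atTop (𝓝 ((y + 1 : ℝ) : ℂ)) :=
    (Complex.continuous_ofReal.tendsto _).comp (hlim.add_const 1)
  refine (spectrum.isClosed T).mem_of_tendsto hlim' (Eventually.of_forall fun n => ?_)
  refine hH.mem_spectrum_of_iterate hw hp0 hp1 hT hz hz0 hz2 n ?_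
  change ((x + 1 : ℝ) : ℂ) = z at hxz
  rw [iterate_cubic hp0 hp1, hc, Complex.ofReal_add, Complex.ofReal_one, add_sub_cancel_right,
    ← ofReal_iterate_centeredCubic, hu, ← hxz, Complex.ofReal_add, Complex.ofReal_one]

theorem image_spectrum_eq (hw : IsSelfSimilarWeight w) (hp0 : 0 < p) (hp1 : p < 1)
    (hp : p ≠ 1 / 2) (hT : ∀ h, coord (T h) = laplacian p (coord h)) :
    (fun z : ℂ => (z : OnePoint ℂ)) '' spectrum ℂ T = cubicJulia p := by
  rw [hH.spectrum_eq hw hp0 hp1 hp hT, cubicJulia_eq hp0 hp1, image_image]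

theorem ofReal_mem_spectrum_iff (hw : IsSelfSimilarWeight w) (hp0 : 0 < p) (hp1 : p < 1)
    (hp : p ≠ 1 / 2) (hT : ∀ h, coord (T h) = laplacian p (coord h)) (t : ℝ) :
    (t : ℂ) ∈ spectrum ℂ T ↔ t - 1 ∈ trappedSet (p * (1 - p)) := by
  rw [← ofReal_mem_cubicJulia_iff hp0 hp1, ← hH.image_spectrum_eq hw hp0 hp1 hp hT,
    OnePoint.coe_injective.mem_set_image]

theorem volume_spectrum (hw : IsSelfSimilarWeight w) (hp0 : 0 < p) (hp1 : p < 1)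
    (hp : p ≠ 1 / 2) (hT : ∀ h, coord (T h) = laplacian p (coord h)) :
    volume {t : ℝ | (t : ℂ) ∈ spectrum ℂ T} = 0 := by
  simp_rw [hH.ofReal_mem_spectrum_iff hw hp0 hp1 hp hT]
  exact volume_shifted_trappedSet hp0 hp1 hp

end IsCoordinates

end PQModel

/-! ### Spectral measures of self-adjoint operators -/

namespace PQModel

open Topology Set

variable {H : Type*} [NormedAddCommGroup H] [InnerProductSpace ℂ H] [CompleteSpace H]

theorem inner_self_adjoint_apply {A : H →L[ℂ] H} (hA : IsSelfAdjoint A) (f : H) :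
    inner ℂ f (A f) = ((inner ℂ f (A f)).re : ℂ) := by
  refine (Complex.conj_eq_iff_re.1 ?_).symm
  rw [inner_conj_symm, ← ContinuousLinearMap.adjoint_inner_right,
    hA.adjoint_eq]

/-- The positive functional `g ↦ ⟪f, g(T) f⟫`. -/
noncomputable def spectralFunctional {T : H →L[ℂ] H} (hT : IsSelfAdjoint T) (f : H) :
    CompactlySupportedContinuousMap (spectrum ℝ T) ℝ →ₚ[ℝ] ℝ :=
  PositiveLinearMap.mk₀
    { toFun := fun g => (inner ℂ f (cfcHom hT g.toContinuousMap f)).re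
      map_add' := fun g h => by
        have : (g + h).toContinuousMap = g.toContinuousMap + h.toContinuousMap := rfl
        rw [this, map_add, add_apply, inner_add_right, Complex.add_re]
      map_smul' := fun r g => by
        have : (r • g).toContinuousMap = r • g.toContinuousMap := rfl
        rw [this, map_smul, smul_apply, inner_smul_right_eq_smul,
          Complex.smul_re, RingHom.id_apply] }
    (by
      intro g hg
      have h0 : 0 ≤ cfcHom hT g.toContinuousMap :=
        (cfcHom_nonneg_iff hT).2 fun x => hg x
      exact ((ContinuousLinearMap.nonneg_iff_isPositive _).1 h0).re_inner_nonneg_right f)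

theorem exists_isSpectralMeasure {T : H →L[ℂ] H} (hT : IsSelfAdjoint T) (f : H) :
    ∃ μ : Measure ℝ, IsSpectralMeasure T f μ ∧ μ {t : ℝ | (t : ℂ) ∉ spectrum ℂ T} = 0 := by
  have hcpt : CompactSpace (spectrum ℝ T) :=
    isCompact_iff_compactSpace.1 (spectrum.isCompact T)
  set ν := RealRMK.rieszMeasure (spectralFunctional hT f) with hν
  refine ⟨ν.map Subtype.val, ⟨inferInstance, fun g hg => ?_⟩, ?_⟩
  · have hsa : IsSelfAdjoint (cfc g T : H →L[ℂ] H) := cfc_predicate g T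
    rw [inner_self_adjoint_apply hsa,
      integral_map measurable_subtype_coe.aemeasurable hg.aestronglyMeasurable]
    let G : CompactlySupportedContinuousMap (spectrum ℝ T) ℝ :=
      ⟨⟨fun x => g x, hg.comp continuous_subtype_val⟩, HasCompactSupport.of_compactSpace _⟩
    have hG : ∫ x, g x ∂ν = (inner ℂ f (cfcHom hT G.toContinuousMap f)).re :=
      RealRMK.integral_rieszMeasure (spectralFunctional hT f) G
    rw [hG, cfc_apply g T hT hg.continuousOn]
    rfl
  · have hm : MeasurableSet {t : ℝ | (t : ℂ) ∉ spectrum ℂ T} :=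
      ((spectrum.isClosed T).preimage Complex.continuous_ofReal).isOpen_compl.measurableSet
    rw [Measure.map_apply measurable_subtype_coe hm]
    convert measure_empty (μ := ν)
    ext ⟨t, ht⟩
    simp only [mem_preimage, mem_ofPred_eq, mem_empty_iff_false, iff_false, not_not]
    exact (spectrum.algebraMap_mem_iff ℂ).2 ht

theorem IsSpectralMeasure.norm_sq_cfc {T : H →L[ℂ] H} {f : H}
    {μ : Measure ℝ} (hμ : IsSpectralMeasure T f μ) {g : ℝ → ℝ} (hg : Continuous g) :
    ‖(cfc g T : H →L[ℂ] H) f‖ ^ 2 = ∫ t, g t ^ 2 ∂μ := by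
  have hsa : IsSelfAdjoint (cfc g T : H →L[ℂ] H) := cfc_predicate g T
  have h1 := hμ.2 (fun t => g t * g t) (hg.mul hg)
  rw [cfc_mul g g T hg.continuousOn hg.continuousOn, mul_apply_eq_comp,
    ← ContinuousLinearMap.adjoint_inner_left, hsa.adjoint_eq, inner_self_eq_norm_sq_to_K] at h1
  simp_rw [sq (g _)]
  refine Complex.ofReal_injective (Eq.trans ?_ h1)
  push_cast
  rfl

/-- The kernel of the adjoint is the orthogonal complement of the range. -/
theorem denseRange_of_adjoint_injective {A : H →L[ℂ] H}
    (h : Function.Injective (ContinuousLinearMap.adjoint A)) : DenseRange A := by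
  have hker : (ContinuousLinearMap.adjoint A).ker = ⊥ := LinearMap.ker_eq_bot.2 h
  have := A.orthogonal_range
  rw [hker, ← Submodule.topologicalClosure_eq_top_iff] at this
  have h2 := (Submodule.dense_iff_topologicalClosure_eq_top).2 this
  have h3 : (A.range : Set H) = range A := LinearMap.coe_range _
  rwa [h3] at h2

/-- A spectral measure has an atom only at an eigenvalue. -/
theorem IsSpectralMeasure.measure_singleton {T : H →L[ℂ] H} (hT : IsSelfAdjoint T) {f : H}
    {μ : Measure ℝ} (hμ : IsSpectralMeasure T f μ) {t : ℝ}
    (hinj : Function.Injective (T - algebraMap ℂ (H →L[ℂ] H) t)) : μ {t} = 0 := by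
  have := hμ.1
  set A := T - algebraMap ℂ (H →L[ℂ] H) t with hA
  have hAsa : IsSelfAdjoint A :=
    hT.sub (IsSelfAdjoint.algebraMap _ (Complex.conj_ofReal t))
  have hdense : DenseRange A := denseRange_of_adjoint_injective (by rwa [hAsa.adjoint_eq])
  have hsmall : ∀ ε > 0, μ.real {t} ≤ ε ^ 2 := by
    intro ε hε
    obtain ⟨k, hk⟩ := hdense.exists_dist_lt f (half_pos hε)
    set δ : ℝ := ε / 2 / (‖k‖ + 1) with hδ
    have hδ0 : 0 < δ := by positivity
    -- A tent of height 1 and half-width `δ` at `t`, so that `g(T)` is a contraction and `‖g(T)(T -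
    -- t)‖ ≤ δ`. As `f` is within `ε/2` of `(T - t)k` and `δ‖k‖ ≤ ε/2`, this gives `‖g(T)f‖ ≤ ε`,
    -- while `μ {t}` is at most `∫ g² dμ = ‖g(T)f‖²`.
    set g : ℝ → ℝ := fun s => max 0 (1 - |s - t| / δ) with hg
    have hgc : Continuous g := by fun_prop
    have hg0 : ∀ s, 0 ≤ g s := fun s => le_max_left _ _
    have hg1 : ∀ s, g s ≤ 1 := fun s =>
      max_le zero_le_one (by have : 0 ≤ |s - t| / δ := by positivity
                             linarith)
    have hgδ : ∀ s, ‖g s * (s - t)‖ ≤ δ := fun s => by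
      rw [norm_mul, Real.norm_of_nonneg (hg0 s), Real.norm_eq_abs]
      rcases le_total (|s - t|) δ with h | h
      · calc g s * |s - t| ≤ 1 * δ := mul_le_mul (hg1 s) h (abs_nonneg _) zero_le_one
          _ = δ := one_mul δ
      · have : g s = 0 := max_eq_left (by rw [sub_nonpos, one_le_div hδ0]; exact h)
        rw [this, zero_mul]
        exact hδ0.le
    have hcomp : (cfc g T : H →L[ℂ] H) * A = cfc (fun s => g s * (s - t)) T := by
      rw [cfc_mul g (fun s => s - t) T hgc.continuousOn (by fun_prop),
        cfc_sub (fun s => s) (fun _ => t) T (by fun_prop) (by fun_prop), cfc_id' ℝ T,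
        cfc_const t T hT]
      rfl
    have hn1 : ‖(cfc g T : H →L[ℂ] H)‖ ≤ 1 :=
      norm_cfc_le zero_le_one fun s _ => by
        rw [Real.norm_of_nonneg (hg0 s)]
        exact hg1 s
    have hn2 : ‖(cfc g T : H →L[ℂ] H) * A‖ ≤ δ := by
      rw [hcomp]
      exact norm_cfc_le hδ0.le fun s _ => hgδ s
    have hle : ‖(cfc g T : H →L[ℂ] H) f‖ ≤ ε := by
      have e : (cfc g T : H →L[ℂ] H) f =
          ((cfc g T : H →L[ℂ] H) * A) k + (cfc g T : H →L[ℂ] H) (f - A k) := by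
        rw [mul_apply_eq_comp, ← map_add, add_sub_cancel]
      rw [e]
      have b1 := ((cfc g T : H →L[ℂ] H) * A).le_of_opNorm_le hn2 k
      have b2 := (cfc g T : H →L[ℂ] H).le_of_opNorm_le hn1 (f - A k)
      rw [dist_eq_norm] at hk
      have b3 : δ * ‖k‖ ≤ ε / 2 := by
        rw [hδ, div_mul_eq_mul_div, div_le_iff₀ (by positivity)]
        nlinarith [norm_nonneg k]
      refine (norm_add_le _ _).trans ?_
      linarith
    calc μ.real {t} = ∫ s, ({t} : Set ℝ).indicator 1 s ∂μ :=
          (integral_indicator_one (measurableSet_singleton t)).symm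
      _ ≤ ∫ s, g s ^ 2 ∂μ := by
          refine integral_mono ((integrable_const (1 : ℝ)).indicator (measurableSet_singleton t))
            ?_ fun s => ?_
          · refine Integrable.of_bound (by fun_prop) 1 (Eventually.of_forall fun s => ?_)
            rw [norm_pow, Real.norm_of_nonneg (hg0 s)]
            exact pow_le_one₀ (hg0 s) (hg1 s)
          · by_cases hs : s = t
            · simp [hs, hg]
            · simp [hs, sq_nonneg]
      _ = ‖(cfc g T : H →L[ℂ] H) f‖ ^ 2 := (hμ.norm_sq_cfc hgc).symm
      _ ≤ ε ^ 2 := pow_le_pow_left₀ (norm_nonneg _) hle 2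
  have hzero : μ.real {t} ≤ 0 := by
    refine le_of_forall_pos_le_add fun ε hε => ?_
    have := hsmall (√ε) (Real.sqrt_pos.2 hε)
    rwa [Real.sq_sqrt hε.le, ← zero_add ε] at this
  exact (measureReal_eq_zero_iff).1 (le_antisymm hzero measureReal_nonneg)

theorem isSingularContinuous_of_null {μ : Measure ℝ} {S : Set ℝ} (hS : MeasurableSet S)
    (hμ : μ Sᶜ = 0) (hvol : volume S = 0) (hatom : ∀ t, μ {t} = 0) : IsSingularContinuous μ :=
  ⟨hatom, Sᶜ, hS.compl, hμ, by rwa [compl_compl]⟩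

end PQModel

/-! ### The Laplacian on the two Hilbert spaces -/

namespace PQModel

open Topology Set ComplexConjugate

theorem laplacian_single (p : ℝ) (x : ℕ) :
    laplacian p (Pi.single x 1) = Pi.single x 1 - (down p (x + 1) : ℂ) • Pi.single (x + 1) 1 -
      (if x = 0 then 0 else (up p (x - 1) : ℂ) • Pi.single (x - 1) 1) := by
  ext k
  have hd : (down p k : ℂ) * (Pi.single x 1 : ℕ → ℂ) (k - 1) =
      (down p (x + 1) : ℂ) * (Pi.single (x + 1) 1 : ℕ → ℂ) k := by
    rcases Nat.eq_zero_or_pos k with rfl | hk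
    · simp [down_zero]
    · by_cases h : k = x + 1
      · simp [h]
      · rw [Pi.single_eq_of_ne h, Pi.single_eq_of_ne (by omega : k - 1 ≠ x), mul_zero, mul_zero]
  have hu : (up p k : ℂ) * (Pi.single x 1 : ℕ → ℂ) (k + 1) =
      (if x = 0 then 0 else (up p (x - 1) : ℂ) • Pi.single (x - 1) 1 : ℕ → ℂ) k := by
    split_ifs with h0
    · rw [Pi.single_eq_of_ne (by omega), mul_zero]
      rfl
    · by_cases h : k = x - 1
      · rw [h, Nat.sub_add_cancel (by omega)]
        simp
      · simp [Pi.single_eq_of_ne h, Pi.single_eq_of_ne (by omega : k + 1 ≠ x)]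
  rw [laplacian, hd, hu]
  simp

theorem conj_iterate_laplacian (p : ℝ) {f : ℕ → ℂ} (hf : ∀ x, conj (f x) = f x) (n : ℕ) (x : ℕ) :
    conj ((laplacian p)^[n] f x) = (laplacian p)^[n] f x := by
  induction n generalizing x with
  | zero => exact hf x
  | succ n ih =>
    rw [Function.iterate_succ_apply']
    simp [laplacian, ih, Complex.conj_ofReal]

/-! ### Adjoint of the Laplacian, residual spectrum and measures of matrix entries -/

section Hilbert

variable {H : Type*} [NormedAddCommGroup H] [InnerProductSpace ℂ H] [CompleteSpace H]

/-- Coordinates of a Hilbert space for which the delta functions are orthogonal. -/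
structure IsHilbertCoordinates (w : ℕ → ℝ) (coord : H →ₗ[ℂ] ℕ → ℂ) : Prop
    extends IsCoordinates w coord where
  inner_single : ∀ x e h, coord e = Pi.single x 1 → inner ℂ e h = w x * coord h x

namespace IsHilbertCoordinates

variable {w : ℕ → ℝ} {coord : H →ₗ[ℂ] ℕ → ℂ} {p : ℝ} {T : H →L[ℂ] H}
  (hH : IsHilbertCoordinates w coord)
include hH

omit [CompleteSpace H] in
theorem exists_single (x : ℕ) : ∃ e, coord e = Pi.single x 1 :=
  (hH.sqSummable_iff _).1 (sqSummable_single w x 1)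

/-- Pairing with the delta function at `x` moves the operator onto it, which produces the transposed
coefficients. -/
theorem mul_coord_adjoint (hT : ∀ h, coord (T h) = laplacian p (coord h)) (h : H) (x : ℕ) :
    w x * coord (ContinuousLinearMap.adjoint T h) x = w x * coord h x -
      down p (x + 1) * w (x + 1) * coord h (x + 1) -
      (if x = 0 then 0 else (up p (x - 1) : ℂ) * w (x - 1) * coord h (x - 1)) := by
  choose e he using hH.exists_single
  have hTe : T (e x) = e x - (down p (x + 1) : ℂ) • e (x + 1) -
      (if x = 0 then 0 else (up p (x - 1) : ℂ) • e (x - 1)) := by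
    refine hH.injective ?_
    rw [hT, he, laplacian_single]
    split_ifs <;> simp [he]
  rw [← hH.inner_single x (e x) _ (he x), ContinuousLinearMap.adjoint_inner_right, hTe,
    inner_sub_left, inner_sub_left, inner_smul_left, hH.inner_single _ _ _ (he x),
    hH.inner_single _ _ _ (he (x + 1)), Complex.conj_ofReal, ← mul_assoc]
  split_ifs with h0
  · rw [inner_zero_left]
  · rw [inner_smul_left, hH.inner_single _ _ _ (he _), Complex.conj_ofReal, ← mul_assoc]

omit hH [CompleteSpace H] in
theorem coord_pow (hT : ∀ h, coord (T h) = laplacian p (coord h)) (n : ℕ) (h : H) :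
    coord ((T ^ n) h) = (laplacian p)^[n] (coord h) := by
  induction n with
  | zero => rfl
  | succ n ih => rw [pow_succ', mul_apply_eq_comp, hT, ih, Function.iterate_succ_apply']

end IsHilbertCoordinates

theorem weight_mul_down {p : ℝ} (hp0 : 0 < p) (hp1 : p < 1) (x : ℕ) :
    (down p (x + 1) : ℂ) * weight p (x + 1) = weight p x * up p x := by
  have := weight_reversible hp0 hp1 x
  rw [mul_comm]
  exact_mod_cast this.symm

theorem up_mul_weight {p : ℝ} (hp0 : 0 < p) (hp1 : p < 1) {x : ℕ} (hx : x ≠ 0) :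
    (up p (x - 1) : ℂ) * weight p (x - 1) = weight p x * down p x := by
  obtain ⟨k, rfl⟩ := Nat.exists_eq_succ_of_ne_zero hx
  have := weight_reversible hp0 hp1 k
  rw [Nat.succ_sub_one, mul_comm]
  exact_mod_cast this

variable {p : ℝ} {T : H →L[ℂ] H}

/-- The Laplacian is self-adjoint with respect to the symmetrizing measure. -/
theorem IsHilbertCoordinates.isSelfAdjoint {coord : H →ₗ[ℂ] ℕ → ℂ} (hp0 : 0 < p) (hp1 : p < 1)
    (hH : IsHilbertCoordinates (weight p) coord)
    (hT : ∀ h, coord (T h) = laplacian p (coord h)) : IsSelfAdjoint T := by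
  rw [ContinuousLinearMap.isSelfAdjoint_iff']
  ext1 h
  refine hH.injective (funext fun x => ?_)
  have hw : (weight p x : ℂ) ≠ 0 := Complex.ofReal_ne_zero.2 (weight_pos x hp0 hp1).ne'
  refine mul_left_cancel₀ hw ?_
  rw [hH.mul_coord_adjoint hT, hT, laplacian, weight_mul_down hp0 hp1]
  split_ifs with h0
  · subst h0
    simp only [down_zero, Complex.ofReal_zero]
    ring
  · rw [up_mul_weight hp0 hp1 h0]
    ring

/-- The unweighted Laplacian has no residual spectrum: an eigenvector of the adjoint is the
product of an eigenfunction with the symmetrizing weight. -/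
theorem IsHilbertCoordinates.denseRange {coord : H →ₗ[ℂ] ℕ → ℂ} (hp0 : 0 < p) (hp1 : p < 1)
    (hH : IsHilbertCoordinates (fun _ => 1) coord)
    (hT : ∀ h, coord (T h) = laplacian p (coord h)) (z : ℂ) :
    DenseRange (T - algebraMap ℂ (H →L[ℂ] H) z) := by
  refine denseRange_of_adjoint_injective ((injective_iff_map_eq_zero _).2 fun g hg => ?_)
  have hadj : ContinuousLinearMap.adjoint T g = conj z • g := by
    rw [map_sub, sub_apply, sub_eq_zero] at hg
    rw [hg, Algebra.algebraMap_eq_smul_one, LinearIsometryEquiv.map_smulₛₗ]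
    simp [← ContinuousLinearMap.star_eq_adjoint]
  have hw : ∀ x, (weight p x : ℂ) ≠ 0 := fun x =>
    Complex.ofReal_ne_zero.2 (weight_pos x hp0 hp1).ne'
  -- Detailed balance turns the transposed equation for `g = π f` into the original eigenvalue
  -- equation for `f`.
  set f : ℕ → ℂ := fun x => coord g x / weight p x with hf
  have hgf : ∀ x, coord g x = weight p x * f x := fun x => (mul_div_cancel₀ _ (hw x)).symm
  have hsum : SqSummable (fun x => weight p x ^ 2) f := by
    refine (hH.sqSummable g).congr fun x => ?_
    rw [hgf, norm_mul, Complex.norm_real, Real.norm_of_nonneg (weight_pos x hp0 hp1).le]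
    ring
  have heig : ∀ x, laplacian p f x = conj z * f x := fun x => by
    have h1 := hH.mul_coord_adjoint hT g x
    rw [hadj, map_smul] at h1
    simp only [Complex.ofReal_one, one_mul, mul_one, Pi.smul_apply, smul_eq_mul, hgf] at h1
    refine mul_left_cancel₀ (hw x) ?_
    rw [laplacian]
    have h2 := weight_mul_down hp0 hp1 x
    split_ifs at h1 with h0
    · subst h0
      simp only [down_zero, Complex.ofReal_zero]
      linear_combination -h1 + f (0 + 1) * h2
    · have h3 := up_mul_weight hp0 hp1 h0
      linear_combination -h1 + f (x + 1) * h2 + f (x - 1) * h3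
  have hf0 := eq_zero_of_eigen hp0 hp1 (isSelfSimilarWeight_weight hp0 hp1).sq hsum heig
  refine hH.injective (funext fun x => ?_)
  rw [hgf, hf0]
  simp

/-- Every vector has a singularly continuous spectral measure. -/
theorem IsHilbertCoordinates.exists_isSingularContinuous {coord : H →ₗ[ℂ] ℕ → ℂ} (hp0 : 0 < p)
    (hp1 : p < 1) (hp : p ≠ 1 / 2) (hH : IsHilbertCoordinates (weight p) coord)
    (hT : ∀ h, coord (T h) = laplacian p (coord h)) (f : H) :
    ∃ μ, IsSpectralMeasure T f μ ∧ IsSingularContinuous μ ∧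
      μ {t : ℝ | (t : ℂ) ∉ spectrum ℂ T} = 0 := by
  have hw := isSelfSimilarWeight_weight hp0 hp1
  have hsa := hH.isSelfAdjoint hp0 hp1 hT
  obtain ⟨μ, hμ, hnull⟩ := exists_isSpectralMeasure hsa f
  refine ⟨μ, hμ, isSingularContinuous_of_null (S := {t : ℝ | (t : ℂ) ∈ spectrum ℂ T}) ?_ hnull
    (hH.volume_spectrum hw hp0 hp1 hp hT) fun t => ?_, hnull⟩
  · exact ((spectrum.isClosed T).preimage Complex.continuous_ofReal).measurableSet
  · exact hμ.measure_singleton hsa (hH.injective_sub_algebraMap hw hp0 hp1 hT t)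

/-- The matrix entries of the powers of the Laplacian are differences of moments of spectral
measures. -/
theorem IsHilbertCoordinates.exists_entry_measures {coord : H →ₗ[ℂ] ℕ → ℂ} (hp0 : 0 < p)
    (hp1 : p < 1) (hp : p ≠ 1 / 2) (hH : IsHilbertCoordinates (weight p) coord)
    (hT : ∀ h, coord (T h) = laplacian p (coord h)) (x y : ℕ) :
    ∃ μ ν : Measure ℝ, IsFiniteMeasure μ ∧ IsFiniteMeasure ν ∧
      μ {t : ℝ | (t : ℂ) ∉ spectrum ℂ T} = 0 ∧ ν {t : ℝ | (t : ℂ) ∉ spectrum ℂ T} = 0 ∧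
      IsSingularContinuous μ ∧ IsSingularContinuous ν ∧
      ∀ n : ℕ, (laplacian p)^[n] (Pi.single y 1) x =
        ((∫ t, t ^ n ∂μ - ∫ t, t ^ n ∂ν : ℝ) : ℂ) := by
  have hsa := hH.isSelfAdjoint hp0 hp1 hT
  obtain ⟨e, he⟩ := hH.exists_single x
  obtain ⟨e', he'⟩ := hH.exists_single y
  have hwx := weight_pos x hp0 hp1
  -- The 4 comes from polarization with `e ± e'`, and the weight from pairing with the delta
  -- function at `x`.
  set r : ℝ≥0∞ := ENNReal.ofReal (4 * weight p x)⁻¹ with hr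
  have hrtop : r ≠ ⊤ := ENNReal.ofReal_ne_top
  have hsmul : ∀ {ρ : Measure ℝ}, IsSingularContinuous ρ → IsSingularContinuous (r • ρ) :=
    fun h => ⟨fun t => by simp [h.1 t], h.2.smul _⟩
  obtain ⟨μ, hμ, hμs, hμ0⟩ := hH.exists_isSingularContinuous hp0 hp1 hp hT (e + e')
  obtain ⟨ν, hν, hνs, hν0⟩ := hH.exists_isSingularContinuous hp0 hp1 hp hT (e - e')
  have hμf := hμ.1
  have hνf := hν.1
  refine ⟨r • μ, r • ν, Measure.smul_finite μ hrtop, Measure.smul_finite ν hrtop,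
    by simp [hμ0], by simp [hν0], hsmul hμs, hsmul hνs, fun n => ?_⟩
  have h1 := hμ.2 (· ^ n) (continuous_pow n)
  have h2 := hν.2 (· ^ n) (continuous_pow n)
  rw [cfc_pow_id T n hsa] at h1 h2
  have h3 : inner ℂ e ((T ^ n) e') = weight p x * (laplacian p)^[n] (Pi.single y 1) x := by
    rw [hH.inner_single x e _ he, IsHilbertCoordinates.coord_pow hT, he']
  -- The matrix entries are real, so the two cross terms agree and two measures suffice where
  -- complex polarization needs four.
  have h4 : inner ℂ e' ((T ^ n) e) = weight p x * (laplacian p)^[n] (Pi.single y 1) x := by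
    have hpow : IsSelfAdjoint (T ^ n) := hsa.pow n
    rw [← ContinuousLinearMap.adjoint_inner_left, hpow.adjoint_eq, ← inner_conj_symm, h3, map_mul,
      Complex.conj_ofReal, conj_iterate_laplacian]
    intro k
    by_cases hk : k = y
    · simp [hk]
    · simp [Pi.single_eq_of_ne hk]
  have h5 : (4 * weight p x : ℂ) * (laplacian p)^[n] (Pi.single y 1) x =
      ((∫ t, t ^ n ∂μ - ∫ t, t ^ n ∂ν : ℝ) : ℂ) := by
    rw [Complex.ofReal_sub, ← h1, ← h2]
    simp only [map_add, map_sub, inner_add_left, inner_add_right, inner_sub_left, inner_sub_right,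
      h3, h4]
    ring
  rw [integral_smul_measure, integral_smul_measure, hr,
    ENNReal.toReal_ofReal (by positivity), ← smul_sub, smul_eq_mul, Complex.ofReal_mul, ← h5]
  have hne : (weight p x : ℂ) ≠ 0 := Complex.ofReal_ne_zero.2 hwx.ne'
  push_cast
  field_simp

end Hilbert

/-! ### Coordinates on `ℓ²(ℤ₊)` -/

section SequenceSpace

/-- The sequence underlying an element of `ℓ²`. -/
def ell2Coord : Ell2 →ₗ[ℂ] ℕ → ℂ where
  toFun f := f
  map_add' _ _ := rfl
  map_smul' _ _ := rfl

theorem isHilbertCoordinates_ell2Coord : IsHilbertCoordinates (fun _ => 1) ell2Coord where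
  injective f g h := lp.ext h
  sqSummable_iff f := by
    have hmem : SqSummable (fun _ => 1) f ↔ Memℓp f 2 := by
      rw [memℓp_gen_iff (by norm_num)]
      simp [SqSummable]
    rw [hmem]
    exact ⟨fun h => ⟨⟨f, h⟩, rfl⟩, fun ⟨g, hg⟩ => hg ▸ lp.memℓp g⟩
  continuous_apply x :=
    (LinearMap.mkContinuous ((LinearMap.proj x).comp ell2Coord) 1 fun f => by
      rw [one_mul]
      exact lp.norm_apply_le_norm two_ne_zero f x).continuous
  inner_single x e h he := by
    have : e = lp.single 2 x 1 := lp.ext he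
    rw [this, lp.inner_single_left]
    simp only [Complex.ofReal_one, one_mul, RCLike.inner_apply, map_one, mul_one]
    rfl

end SequenceSpace

/-! ### Coordinates on `L²(ℤ₊, π)` -/

section WeightedSpace

variable {p : ℝ} (hp0 : 0 < p) (hp1 : p < 1)
include hp0 hp1

/-- Every point has positive mass, so classes modulo null sets are genuine functions. -/
theorem ae_piMeasure_iff {P : ℕ → Prop} : (∀ᵐ x ∂piMeasure p, P x) ↔ ∀ x, P x := by
  rw [ae_iff_of_countable]
  refine forall_congr' fun x => ⟨fun h => h ?_, fun h _ => h⟩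
  rw [piMeasure, Measure.sum_apply _ (measurableSet_singleton x), ← pos_iff_ne_zero]
  refine lt_of_lt_of_le ?_ (ENNReal.le_tsum x)
  simpa using weight_pos x hp0 hp1

theorem integrable_piMeasure_iff {f : ℕ → ℝ} :
    Integrable f (piMeasure p) ↔ Summable fun x => weight p x * ‖f x‖ := by
  rw [piMeasure, integrable_sum_dirac_iff fun _ => ENNReal.ofReal_ne_top]
  simp_rw [ENNReal.toReal_ofReal (weight_pos _ hp0 hp1).le]

theorem memLp_piMeasure_iff {f : ℕ → ℂ} : MemLp f 2 (piMeasure p) ↔ SqSummable (weight p) f := by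
  rw [memLp_two_iff_integrable_sq_norm .of_discrete, integrable_piMeasure_iff hp0 hp1]
  simp [SqSummable]

/-- The function underlying an element of `L²(ℤ₊, π)`. -/
noncomputable def l2piCoord : L2pi p →ₗ[ℂ] ℕ → ℂ where
  toFun f := f
  map_add' f g := funext ((ae_piMeasure_iff hp0 hp1).1 (Lp.coeFn_add f g))
  map_smul' c f := funext ((ae_piMeasure_iff hp0 hp1).1 (Lp.coeFn_smul c f))

theorem integral_piMeasure (f : ℕ → ℂ) :
    ∫ x, f x ∂piMeasure p = ∑' x, weight p x • f x := by
  rw [piMeasure, integral_sum_dirac fun _ => ENNReal.ofReal_ne_top]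
  simp_rw [ENNReal.toReal_ofReal (weight_pos _ hp0 hp1).le]

theorem inner_l2pi_single (x : ℕ) {e : L2pi p} (h : L2pi p)
    (he : (e : ℕ → ℂ) = Pi.single x 1) : inner ℂ e h = weight p x * (h : ℕ → ℂ) x := by
  rw [L2.inner_def, he, integral_piMeasure hp0 hp1, tsum_eq_single x]
  · simp
  · intro y hy
    simp [Pi.single_eq_of_ne hy]

theorem isHilbertCoordinates_l2piCoord :
    IsHilbertCoordinates (weight p) (l2piCoord hp0 hp1) where
  injective f g h := Lp.ext (Eventually.of_forall (congrFun h))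
  sqSummable_iff f := by
    rw [← memLp_piMeasure_iff hp0 hp1]
    refine ⟨fun h => ⟨h.toLp f, funext ((ae_piMeasure_iff hp0 hp1).1 h.coeFn_toLp)⟩, ?_⟩
    rintro ⟨g, rfl⟩
    exact Lp.memLp g
  continuous_apply x := by
    have hmem : MemLp (Pi.single x 1 : ℕ → ℂ) 2 (piMeasure p) :=
      (memLp_piMeasure_iff hp0 hp1).2 (sqSummable_single _ x 1)
    have he := funext ((ae_piMeasure_iff hp0 hp1).1 hmem.coeFn_toLp)
    have hw : (weight p x : ℂ) ≠ 0 := Complex.ofReal_ne_zero.2 (weight_pos x hp0 hp1).ne'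
    have : (fun h => l2piCoord hp0 hp1 h x) =
        fun h => (weight p x : ℂ)⁻¹ * inner ℂ (hmem.toLp _) h := by
      ext h
      rw [inner_l2pi_single hp0 hp1 x h he, inv_mul_cancel_left₀ hw]
      rfl
    rw [this]
    fun_prop
  inner_single x e h he := inner_l2pi_single hp0 hp1 x h he

end WeightedSpace

end PQModel

/-! ### The main theorem -/

open PQModel in
theorem theorem2p1 (p : ℝ) (hp0 : 0 < p) (hp1 : p < 1) (hp : p ≠ 1 / 2) :
    (∃ T : Ell2 →L[ℂ] Ell2, IsLaplacianEll2 p T ∧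
      HasPurelySCSpectrumEll2 T ∧
      (fun z : ℂ => (z : OnePoint ℂ)) '' spectrum ℂ T = cubicJulia p) ∧
    (∃ T : L2pi p →L[ℂ] L2pi p, IsLaplacianL2pi p T ∧
      HasPurelySCSpectrum T ∧
      (fun z : ℂ => (z : OnePoint ℂ)) '' spectrum ℂ T = cubicJulia p) ∧
    Nonempty (cubicJulia p ≃ₜ cantorSet) ∧
    cubicJulia p ⊆ Set.range (fun t : ℝ => ((t : ℂ) : OnePoint ℂ)) ∧
    MeasureTheory.volume {t : ℝ | ((t : ℂ) : OnePoint ℂ) ∈ cubicJulia p} = 0 := by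
  have hwπ := isSelfSimilarWeight_weight hp0 hp1
  have hπ := isHilbertCoordinates_l2piCoord hp0 hp1
  have hw1 := isSelfSimilarWeight_one
  have h1 := isHilbertCoordinates_ell2Coord
  obtain ⟨S, hS⟩ := hπ.exists_laplacian hwπ hp0 hp1
  obtain ⟨T, hT⟩ := h1.exists_laplacian hw1 hp0 hp1
  -- The measures for the `ℓ²` operator are those built in `L²(π)`: the entries of `Δ_pⁿ` do not
  -- depend on the space, and the two spectra coincide.
  have hspec : ∀ t : ℝ, (t : ℂ) ∈ spectrum ℂ S ↔ (t : ℂ) ∈ spectrum ℂ T := fun t => by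
    rw [hπ.ofReal_mem_spectrum_iff hwπ hp0 hp1 hp hS, h1.ofReal_mem_spectrum_iff hw1 hp0 hp1 hp hT]
  refine ⟨⟨T, fun f x => congrFun (hT f) x, ⟨⟨fun z hz => ?_, ?_⟩, fun z _ => ⟨?_, ?_⟩,
    fun x y => ?_⟩, h1.image_spectrum_eq hw1 hp0 hp1 hp hT⟩,
    ⟨S, fun f x => congrFun (hS f) x, ⟨hπ.isSelfAdjoint hp0 hp1 hS, fun f => ?_⟩,
      hπ.image_spectrum_eq hwπ hp0 hp1 hp hS⟩,
    nonempty_cubicJulia_homeomorph_cantorSet hp0 hp1 hp, cubicJulia_subset_range hp0 hp1,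
    volume_cubicJulia hp0 hp1 hp⟩
  · obtain ⟨t, -, rfl⟩ := h1.spectrum_subset hw1 hp0 hp1 hT hz
    exact Complex.ofReal_im _
  · exact h1.volume_spectrum hw1 hp0 hp1 hp hT
  · exact h1.injective_sub_algebraMap hw1 hp0 hp1 hT z
  · exact h1.denseRange hp0 hp1 hT z
  · obtain ⟨μ, ν, hμ, hν, hμ0, hν0, hμs, hνs, hμν⟩ :=
      hπ.exists_entry_measures hp0 hp1 hp hS x y
    simp_rw [hspec] at hμ0 hν0
    refine ⟨μ, ν, ⟨hμ, hν, hμ0, hν0, fun n => ?_⟩, hμs, hνs⟩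
    rw [← hμν n]
    have := congrFun (IsHilbertCoordinates.coord_pow hT n (lp.single 2 y 1)) x
    exact this
  · obtain ⟨μ, hμ, hμs, -⟩ := hπ.exists_isSingularContinuous hp0 hp1 hp hS f
    exact ⟨μ, hμ, hμs⟩
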